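/- **Theorem 6.3.** A function $h\colon\{0,1\}^n\to\{-1,+1\}$ is a *halfspace* if there are reals $a_1,\dots,a_n,\theta$ such that $h(x)=\operatorname{sign}(a_1x_1+\cdots+a_nx_n-\theta)$ for all $x\in\{0,1\}^n$, where $\operatorname{sign}t=-1,0,1$ for $t<0$, $t=0$, $t>0$, respectively. Regard $-1$ as "true" and $+1$ as "false". Let $\mathrm{MAJ}_n\colon\{0,1\}^n\to\{-1,+1\}$ be given by $\mathrm{MAJ}_n(x)=-1$ if $x_1+\cdots+x_n>n/2$ and $\mathrm{MAJ}_n(x)=1$ otherwise. For $f,g\colon\{0,1\}^n\to\{-1,+1\}$, let $f\wedge g\colon\{0,1\}^n\times\{0,1\}^n\to\{-1,+1\}$ be the function with $(f\wedge g)(x,y)=-1$ if $f(x)=g(y)=-1$, and $(f\wedge g)(x,y)=1$ otherwise. For $F\colon\{0,1\}^N\to\{-1,+1\}$, let the *threshold degree* $\deg_\pm(F)$ be the least total degree of a real polynomial $p$ in $N$ variables with $F(z)=\operatorname{sign}p(z)$ for all $z\in\{0,1\}^N$. Then there is a family of halfspaces $h_n\colon\{0,1\}^n\to\{-1,+1\}$,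 $n=1,2,3,\dots$, such that $$\deg_\pm(h_n\wedge \mathrm{MAJ}_n)=\Theta\bigl(\sqrt{n\log_2 n}\bigr)\qquad(n\to\infty),$$ that is, there are constants $c,C>0$ with $c\sqrt{n\log_2 n}\le\deg_\pm(h_n\wedge\mathrm{MAJ}_n)\le C\sqrt{n\log_2 n}$ for all sufficiently large $n$. -/

import Mathlib

open Filter Asymptotics

/-- The real vector in `{0,1}^σ` that a Boolean vector stands for. -/
def cubePoint {σ : Type*} (x : σ → Bool) : σ → ℝ := fun i => if x i then 1 else 0

/-- `h : {0,1}^n → {-1,+1}` is a halfspace: `h(x) = sign(∑ aᵢ xᵢ - θ)` for some reals `aᵢ, θ`.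
Here `{-1,+1}` is `ℤˣ`, and since `sign 0 = 0`, the linear form never vanishes on the cube. -/
def IsHalfspace {n : ℕ} (h : (Fin n → Bool) → ℤˣ) : Prop :=
  ∃ (a : Fin n → ℝ) (θ : ℝ), ∀ x : Fin n → Bool,
    (((h x : ℤˣ) : ℤ) : ℝ) = Real.sign (∑ i, a i * cubePoint x i - θ)

/-- The majority function on `{0,1}^n`: `-1` (true) if `x₁ + ⋯ + xₙ > n / 2`, and `1` otherwise. -/
noncomputable def majority (n : ℕ) (x : Fin n → Bool) : ℤˣ :=
  open Classical in if (n : ℝ) / 2 < ∑ i, cubePoint x i then -1 else 1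

/-- The conjunction `(f ∧ g)(x, y) = f(x) ∧ g(y)` of two Boolean functions on disjoint sets of
variables, where `-1` is "true" and `1` is "false". -/
def conjunction {σ τ : Type*} (f : (σ → Bool) → ℤˣ) (g : (τ → Bool) → ℤˣ) :
    (σ ⊕ τ → Bool) → ℤˣ := fun z =>
  if f (fun i => z (Sum.inl i)) = -1 ∧ g (fun j => z (Sum.inr j)) = -1 then -1 else 1

/-- The threshold degree of `f : {0,1}^σ → {-1,+1}`: the least total degree of a real polynomial
`p` with `f(x) = sign p(x)` on the whole cube.  (For finite `σ`, every `f` is a polynomial on the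
cube, so the set is nonempty.) -/
noncomputable def thresholdDegree {σ : Type*} (f : (σ → Bool) → ℤˣ) : ℕ :=
  sInf {d : ℕ | ∃ p : MvPolynomial σ ℝ, p.totalDegree = d ∧
    ∀ x : σ → Bool, (((f x : ℤˣ) : ℤ) : ℝ) = Real.sign (MvPolynomial.eval (cubePoint x) p)}

/-! Let `Φ(x, y)` of degree `d` sign-represent `f ∧ g`. Mixing its columns or its rows with weights
from minimax duality gives, for each `a > 0`, one of two things: a quotient `p / q` of degree `d`
with the sign of `f` and `|p / q|` in `[a, 1]`, or a quotient `P / Q` of degree `2d` that is at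
least `1/2` on `g⁻¹(-1)` and at most `2a²` on `g⁻¹(1)` (`rational_approximation_of_conjunction`).
For `d` a small multiple of `√(n log n)` and `a = 2^(-Θ(n/d))` both are impossible when `g` is
majority and `f` is a suitable halfspace.

The halfspace. On the real line, a quotient of degree `d` cannot approximate the sign within ratio
`a` at the points `±B^j`, `j ≤ 100d`, if `aB ≥ 2`: at some scale no root interferes, numerator and
denominator look like monomials of opposite parity, and their quotient drifts by a factor `B`
(`not_sign_approximation`). To plant this problem in `n` bits, one takes coefficients modulo some `M
= 2^(Θ(n))` for which every fibre of `∑ z i x i` modulo `M` carries a probability distribution that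
degree `d` cannot tell from the uniform one (`exists_moment_matching`). Subtracting `M` times the
number of ones in a second block of bits leaves exactly the residue `t`, and averaging turns
functions of degree `d` into polynomials of degree `d` in `t` (`exists_polynomial_fibreAverage`).

Majority. Symmetrization makes `P` and `Q` univariate polynomials `R` and `S`. With `c = n / 2`, the
product `F(v) = R(c + v) S(c - v)` would be far larger at every `v` in `1, …, c` than at `-v`, but
on integers a polynomial of degree `4d` cannot beat the factor `exp(O(d / log n))`
(`exists_abs_eval_le_exp_mul`). The conflict arises when `d / log n` is small against `n / d`.

The upper bound needs no explicit polynomial. Fixing one coordinate lowers the threshold degree by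
at most one, and fixing all of them leaves degree at most one, so restrictions of the hard halfspace
attain every positive degree below its own (`exists_halfspace_thresholdDegree_eq`); `h` is chosen
with degree exactly `intersectionDegree n + 1`. -/

/-! ### Functions of low degree on the cube -/

/-- The multilinear monomial `∏ i ∈ S, x i` on the cube. -/
def cubeMonomial {σ : Type*} (S : Finset σ) (x : σ → Bool) : ℝ := ∏ i ∈ S, cubePoint x i

/-- The functions on the cube that are given by polynomials of degree at most `d`. -/
def lowDegree (σ : Type*) (d : ℕ) : Submodule ℝ ((σ → Bool) → ℝ) :=
  Submodule.span ℝ {f | ∃ S : Finset σ, S.card ≤ d ∧ f = cubeMonomial S}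

section LowDegree

variable {σ τ : Type*} {d e : ℕ}

lemma cubePoint_pow (x : σ → Bool) (i : σ) {k : ℕ} (hk : k ≠ 0) :
    cubePoint x i ^ k = cubePoint x i := by
  unfold cubePoint; split_ifs <;> simp [hk]

lemma cubeMonomial_mem {S : Finset σ} (h : S.card ≤ d) : cubeMonomial S ∈ lowDegree σ d :=
  Submodule.subset_span ⟨S, h, rfl⟩

lemma cubeMonomial_eq (S : Finset σ) (x : σ → Bool) :
    cubeMonomial S x = if ∀ i ∈ S, x i = true then 1 else 0 := by
  unfold cubeMonomial cubePoint
  exact Finset.prod_ite_zero.trans (by simp)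

lemma cubeMonomial_mul [DecidableEq σ] (S T : Finset σ) :
    cubeMonomial S * cubeMonomial T = cubeMonomial (S ∪ T) := by
  funext x
  have h : (∀ i ∈ S ∪ T, x i = true) ↔ (∀ i ∈ S, x i = true) ∧ ∀ i ∈ T, x i = true :=
    Finset.forall_mem_union
  simp only [Pi.mul_apply, cubeMonomial_eq, h]
  by_cases h1 : ∀ i ∈ S, x i = true
  · by_cases h2 : ∀ i ∈ T, x i = true
    · rw [if_pos h1, if_pos h2, if_pos ⟨h1, h2⟩, one_mul]
    · rw [if_neg h2, mul_zero, if_neg fun hc => h2 hc.2]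
  · rw [if_neg h1, zero_mul, if_neg fun hc => h1 hc.1]

lemma lowDegree_mono (h : d ≤ e) : lowDegree σ d ≤ lowDegree σ e :=
  Submodule.span_mono fun _ ⟨S, hS, hf⟩ => ⟨S, hS.trans h, hf⟩

lemma const_mem_lowDegree (c : ℝ) : (fun _ => c : (σ → Bool) → ℝ) ∈ lowDegree σ d := by
  have : (fun _ => c : (σ → Bool) → ℝ) = c • cubeMonomial ∅ := by
    funext x; simp [cubeMonomial]
  rw [this]
  exact Submodule.smul_mem _ _ (cubeMonomial_mem (by simp))

lemma cubePoint_mem_lowDegree (i : σ) : (fun x => cubePoint x i) ∈ lowDegree σ 1 := by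
  have : (fun x : σ → Bool => cubePoint x i) = cubeMonomial {i} := by
    funext x; simp [cubeMonomial]
  rw [this]
  exact cubeMonomial_mem (by simp)

lemma lowDegree_mul {f g : (σ → Bool) → ℝ} (hf : f ∈ lowDegree σ d) (hg : g ∈ lowDegree σ e) :
    f * g ∈ lowDegree σ (d + e) := by
  classical
  have : lowDegree σ d * lowDegree σ e ≤ lowDegree σ (d + e) := by
    unfold lowDegree
    rw [Submodule.span_mul_span]
    refine Submodule.span_mono ?_
    rintro _ ⟨_, ⟨S, hS, rfl⟩, _, ⟨T, hT, rfl⟩, rfl⟩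
    exact ⟨S ∪ T, (Finset.card_union_le _ _).trans (by omega), cubeMonomial_mul S T⟩
  exact this (Submodule.mul_mem_mul hf hg)

lemma lowDegree_pow {f : (σ → Bool) → ℝ} (hf : f ∈ lowDegree σ d) (k : ℕ) :
    f ^ k ∈ lowDegree σ (d * k) := by
  induction k with
  | zero => exact const_mem_lowDegree 1
  | succ k ih => rw [pow_succ, mul_add, mul_one]; exact lowDegree_mul ih hf

/-- A univariate polynomial of degree `k` in an affine function has degree at most `k`. -/
lemma polynomial_eval_mem_lowDegree {f : (σ → Bool) → ℝ} (hf : f ∈ lowDegree σ 1)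
    (p : Polynomial ℝ) (hp : p.natDegree ≤ d) : (fun x => p.eval (f x)) ∈ lowDegree σ d := by
  have : (fun x => p.eval (f x)) = ∑ k ∈ Finset.range (p.natDegree + 1), p.coeff k • f ^ k := by
    funext x
    simp [Polynomial.eval_eq_sum_range]
  rw [this]
  refine Submodule.sum_mem _ fun k hk => Submodule.smul_mem _ _ ?_
  have := lowDegree_pow hf k
  rw [one_mul] at this
  exact lowDegree_mono (by simp at hk; omega) this

lemma eval_mem_lowDegree (p : MvPolynomial σ ℝ) (hp : p.totalDegree ≤ d) :
    (fun x => MvPolynomial.eval (cubePoint x) p) ∈ lowDegree σ d := by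
  have : (fun x => MvPolynomial.eval (cubePoint x) p) =
      ∑ m ∈ p.support, p.coeff m • (cubeMonomial m.support : (σ → Bool) → ℝ) := by
    funext x
    rw [MvPolynomial.eval_eq]
    simp only [Finset.sum_apply, Pi.smul_apply, smul_eq_mul, cubeMonomial]
    refine Finset.sum_congr rfl fun m _ => ?_
    congr 1
    exact Finset.prod_congr rfl fun i hi => cubePoint_pow x i (Finsupp.mem_support_iff.1 hi)
  rw [this]
  refine Submodule.sum_mem _ fun m hm => Submodule.smul_mem _ _ (cubeMonomial_mem ?_)
  refine le_trans ?_ ((MvPolynomial.le_totalDegree hm).trans hp)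
  rw [Finset.card_eq_sum_ones]
  exact Finset.sum_le_sum fun i hi => Nat.one_le_iff_ne_zero.2 (Finsupp.mem_support_iff.1 hi)

lemma exists_polynomial_of_mem_lowDegree {f : (σ → Bool) → ℝ} (hf : f ∈ lowDegree σ d) :
    ∃ p : MvPolynomial σ ℝ, p.totalDegree ≤ d ∧ ∀ x, f x = MvPolynomial.eval (cubePoint x) p := by
  induction hf using Submodule.span_induction with
  | mem f hf =>
    obtain ⟨S, hS, rfl⟩ := hf
    refine ⟨∏ i ∈ S, MvPolynomial.X i, ?_, fun x => by simp [cubeMonomial]⟩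
    refine (MvPolynomial.totalDegree_finsetProd S _).trans ?_
    simpa using hS
  | zero => exact ⟨0, by simp, by simp⟩
  | add f g _ _ hf hg =>
    obtain ⟨p, hp, hpe⟩ := hf
    obtain ⟨q, hq, hqe⟩ := hg
    exact ⟨p + q, (MvPolynomial.totalDegree_add p q).trans (max_le hp hq),
      fun x => by simp [hpe, hqe]⟩
  | smul a f _ hf =>
    obtain ⟨p, hp, hpe⟩ := hf
    exact ⟨a • p, (MvPolynomial.totalDegree_smul_le a p).trans hp, fun x => by simp [hpe]⟩

/-- Substituting coordinates or constants for the coordinates does not increase the degree. -/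
lemma lowDegree_comp {f : (σ → Bool) → ℝ} (hf : f ∈ lowDegree σ d)
    (u : (τ → Bool) → σ → Bool) (hu : ∀ i, (∃ j, ∀ y, u y i = y j) ∨ ∃ b, ∀ y, u y i = b) :
    (fun y => f (u y)) ∈ lowDegree τ d := by
  induction hf using Submodule.span_induction with
  | mem f hf =>
    obtain ⟨S, hS, rfl⟩ := hf
    -- Sharpening the bound to `S.card` lets the induction on `S` gain one degree per coordinate.
    refine lowDegree_mono hS ?_
    clear hS
    classical
    induction S using Finset.induction_on with
    | empty => simpa [cubeMonomial] using const_mem_lowDegree (1 : ℝ)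
    | insert i S hi ih =>
      have : (fun y => cubeMonomial (insert i S) (u y)) =
          (fun y => cubeMonomial S (u y)) * fun y => cubePoint (u y) i := by
        funext y; simp [cubeMonomial, Finset.prod_insert hi, mul_comm]
      rw [this, Finset.card_insert_of_notMem hi]
      refine lowDegree_mul ih ?_
      rcases hu i with ⟨j, hj⟩ | ⟨b, hb⟩
      · simpa [cubePoint, hj] using cubePoint_mem_lowDegree j
      · simpa [cubePoint, hb] using const_mem_lowDegree (if b then (1 : ℝ) else 0)
  | zero => exact Submodule.zero_mem _
  | add f g _ _ hf hg => exact Submodule.add_mem _ hf hg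
  | smul a f _ hf => exact Submodule.smul_mem _ a hf

/-- Expand in indicators of points, each a product of one affine factor per coordinate. This makes
the set of degrees in `thresholdDegree` nonempty. -/
lemma mem_lowDegree_card [Fintype σ] (f : (σ → Bool) → ℝ) : f ∈ lowDegree σ (Fintype.card σ) := by
  classical
  have key : ∀ (a : σ → Bool) (S : Finset σ),
      (fun x => ∏ i ∈ S, if x i = a i then (1 : ℝ) else 0) ∈ lowDegree σ S.card := by
    intro a S
    induction S using Finset.induction_on with
    | empty => simpa using const_mem_lowDegree (1 : ℝ)
    | insert i S hi ih =>
      have : (fun x : σ → Bool => ∏ j ∈ insert i S, if x j = a j then (1 : ℝ) else 0) =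
          (fun x => ∏ j ∈ S, if x j = a j then (1 : ℝ) else 0) *
            fun x => if x i = a i then (1 : ℝ) else 0 := by
        funext y; simp [Finset.prod_insert hi, mul_comm]
      rw [this, Finset.card_insert_of_notMem hi]
      refine lowDegree_mul ih ?_
      cases hai : a i
      · have : (fun x : σ → Bool => if x i = false then (1 : ℝ) else 0) =
            (fun _ => 1) - fun x => cubePoint x i := by
          funext x; simp only [Pi.sub_apply, cubePoint]; cases x i <;> norm_num
        rw [this]
        exact Submodule.sub_mem _ (const_mem_lowDegree 1) (cubePoint_mem_lowDegree i)
      · exact cubePoint_mem_lowDegree i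
  have : f = ∑ a : σ → Bool, f a • fun x => ∏ i, if x i = a i then (1 : ℝ) else 0 := by
    funext x
    simp only [Finset.sum_apply, Pi.smul_apply, smul_eq_mul]
    rw [Finset.sum_eq_single x]
    · simp
    · intro a _ ha
      obtain ⟨i, hi⟩ := Function.ne_iff.1 ha
      rw [Finset.prod_eq_zero (Finset.mem_univ i) (by rw [if_neg hi.symm]), mul_zero]
    · simp
  rw [this]
  exact Submodule.sum_mem _ fun a _ => Submodule.smul_mem _ _ (key a Finset.univ)

/-- `f` sign-represents `F`. -/
def SignRepresents (f : (σ → Bool) → ℝ) (F : (σ → Bool) → ℤˣ) : Prop :=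
  ∀ x, 0 < (((F x : ℤˣ) : ℤ) : ℝ) * f x

lemma units_cast_cases (u : ℤˣ) : ((u : ℤ) : ℝ) = 1 ∨ ((u : ℤ) : ℝ) = -1 := by
  rcases Int.units_eq_one_or u with h | h <;> simp [h]

lemma units_eq_sign_iff (u : ℤˣ) (r : ℝ) : ((u : ℤ) : ℝ) = Real.sign r ↔ 0 < ((u : ℤ) : ℝ) * r := by
  rcases lt_trichotomy r 0 with h | h | h <;> rcases units_cast_cases u with hu | hu <;>
    simp only [hu, Real.sign_of_neg, Real.sign_of_pos, h, Real.sign_zero] <;> norm_num <;> linarith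

lemma thresholdDegree_le_iff [Finite σ] {F : (σ → Bool) → ℤˣ} :
    thresholdDegree F ≤ d ↔ ∃ f ∈ lowDegree σ d, SignRepresents f F := by
  have := Fintype.ofFinite σ
  constructor
  · intro h
    -- In `ℕ`, `sInf ∅ = 0`; the infimum is attained only because the set is nonempty.
    have hne : {d : ℕ | ∃ p : MvPolynomial σ ℝ, p.totalDegree = d ∧ ∀ x : σ → Bool,
        (((F x : ℤˣ) : ℤ) : ℝ) = Real.sign (MvPolynomial.eval (cubePoint x) p)}.Nonempty := by
      obtain ⟨p, -, hp⟩ := exists_polynomial_of_mem_lowDegree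
        (mem_lowDegree_card fun x => (((F x : ℤˣ) : ℤ) : ℝ))
      refine ⟨_, p, rfl, fun x => ?_⟩
      rw [units_eq_sign_iff, ← hp]
      rcases units_cast_cases (F x) with h | h <;> simp [h]
    obtain ⟨p, hp, hs⟩ := Nat.sInf_mem hne
    exact ⟨_, eval_mem_lowDegree p (hp.trans_le h), fun x => (units_eq_sign_iff _ _).1 (hs x)⟩
  · rintro ⟨f, hf, hs⟩
    obtain ⟨p, hp, hpe⟩ := exists_polynomial_of_mem_lowDegree hf
    refine le_trans (Nat.sInf_le ⟨p, rfl, fun x => ?_⟩) hp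
    rw [units_eq_sign_iff, ← hpe]
    exact hs x

end LowDegree

/-! ### A theorem of the alternative, and conjunctions -/

/-- Ville's theorem of the alternative. -/
theorem ville_alternative {I J : Type*} [Fintype I] [Fintype J] (A : I → J → ℝ) :
    (∃ w : J → ℝ, (∀ j, 0 ≤ w j) ∧ ∑ j, w j = 1 ∧ ∀ i, 0 ≤ ∑ j, w j * A i j) ∨
    (∃ u : I → ℝ, (∀ i, 0 ≤ u i) ∧ ∀ j, ∑ i, u i * A i j < 0) := by
  classical
  let φ : (J → ℝ) →ₗ[ℝ] (I → ℝ) :=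
    { toFun := fun w i => ∑ j, w j * A i j
      map_add' := fun v w => by
        funext i; simp [add_mul, Finset.sum_add_distrib]
      map_smul' := fun c w => by
        funext i; simp [Finset.mul_sum, mul_assoc] }
  -- `C` is the compact convex set of mixed columns and `K` the nonnegative orthant. A common point
  -- is the first alternative; otherwise a strictly separating functional supplies `u`.
  let C : Set (I → ℝ) := φ '' stdSimplex ℝ J
  let K : Set (I → ℝ) := {v | ∀ i, 0 ≤ v i}
  by_cases hd : Disjoint C K
  · right
    have hC : Convex ℝ C := (convex_stdSimplex ℝ J).linear_image φ
    have hCc : IsCompact C :=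
      (isCompact_stdSimplex ℝ J).image (LinearMap.continuous_of_finiteDimensional φ)
    have hK : Convex ℝ K := by
      intro v hv w hw a b ha hb _ i
      have := hv i; have := hw i
      simp only [Pi.add_apply, Pi.smul_apply, smul_eq_mul]
      positivity
    have hKc : IsClosed K := by
      have : K = ⋂ i, {v | 0 ≤ v i} := by ext; simp [K]
      rw [this]
      exact isClosed_iInter fun i => isClosed_le continuous_const (continuous_apply i)
    obtain ⟨f, s, t, hs, hst, ht⟩ := geometric_hahn_banach_compact_closed hC hCc hK hKc hd
    have hrep : ∀ v, f v = ∑ i, f (Pi.single i 1) * v i := by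
      intro v
      have : v = ∑ i, v i • (Pi.single i 1 : I → ℝ) := by
        funext k; simp [Pi.single_apply]
      conv_lhs => rw [this]
      simp [mul_comm]
    have ht0 : t < 0 := by simpa using ht 0 (fun i => le_rfl)
    refine ⟨fun i => f (Pi.single i 1), fun i => ?_, fun j => ?_⟩
    -- A negative coefficient would give a multiple of this basis vector that lies in `K` and has
    -- value exactly `t`.
    · by_contra hneg
      push Not at hneg
      have := ht ((t / f (Pi.single i 1)) • Pi.single i 1) (fun k => by
        simp only [Pi.smul_apply, smul_eq_mul]
        refine mul_nonneg (div_nonneg_of_nonpos ht0.le hneg.le) ?_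
        simp only [Pi.single_apply]; split_ifs <;> norm_num)
      rw [map_smul, smul_eq_mul, div_mul_cancel₀ _ hneg.ne] at this
      exact lt_irrefl _ this
    · have := hs (φ (Pi.single j 1)) ⟨_, single_mem_stdSimplex ℝ j, rfl⟩
      rw [hrep] at this
      simp only [φ, LinearMap.coe_mk, AddHom.coe_mk, Pi.single_apply, ite_mul, one_mul, zero_mul,
        Finset.sum_ite_eq', Finset.mem_univ, if_true] at this
      linarith
  · left
    obtain ⟨_, ⟨w, hw, rfl⟩, hv⟩ := Set.not_disjoint_iff.1 hd
    exact ⟨w, hw.1, hw.2, hv⟩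

section Conjunction

variable {σ τ : Type*} {d : ℕ}

lemma signRepresents_conjunction_iff {f : (σ → Bool) → ℤˣ} {g : (τ → Bool) → ℤˣ}
    {φ : (σ ⊕ τ → Bool) → ℝ} : SignRepresents φ (conjunction f g) ↔
      ∀ x y, (f x = -1 ∧ g y = -1 → φ (Sum.elim x y) < 0) ∧
        (¬ (f x = -1 ∧ g y = -1) → 0 < φ (Sum.elim x y)) := by
  constructor
  · intro h x y
    have := h (Sum.elim x y)
    have e : conjunction f g (Sum.elim x y) = if f x = -1 ∧ g y = -1 then -1 else 1 := rfl
    rw [e] at this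
    constructor <;> intro hfg
    · rw [if_pos hfg] at this; simpa using this
    · rw [if_neg hfg] at this; simpa using this
  · intro h z
    have := h (fun i => z (Sum.inl i)) (fun j => z (Sum.inr j))
    have hz : Sum.elim (fun i => z (Sum.inl i)) (fun j => z (Sum.inr j)) = z := by
      funext k; cases k <;> rfl
    rw [hz] at this
    unfold conjunction
    split_ifs with hc
    · simpa using this.1 hc
    · simpa using this.2 hc

lemma lowDegree_elim_left {φ : (σ ⊕ τ → Bool) → ℝ} (hφ : φ ∈ lowDegree (σ ⊕ τ) d) (y : τ → Bool) :
    (fun x => φ (Sum.elim x y)) ∈ lowDegree σ d := by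
  refine lowDegree_comp hφ _ fun k => ?_
  cases k with
  | inl i => exact Or.inl ⟨i, fun _ => rfl⟩
  | inr j => exact Or.inr ⟨y j, fun _ => rfl⟩

lemma lowDegree_elim_right {φ : (σ ⊕ τ → Bool) → ℝ} (hφ : φ ∈ lowDegree (σ ⊕ τ) d) (x : σ → Bool) :
    (fun y => φ (Sum.elim x y)) ∈ lowDegree τ d := by
  refine lowDegree_comp hφ _ fun k => ?_
  cases k with
  | inl i => exact Or.inr ⟨x i, fun _ => rfl⟩
  | inr j => exact Or.inl ⟨j, fun _ => rfl⟩

/-- A sign-representation of a conjunction of degree `d` gives a rational approximation to one of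
the two functions: either an approximation of `f` with quotients in `[a, 1]` in absolute value, or
a rational function that is at least `1 / 2` on `g⁻¹(-1)` and at most `2 a ^ 2` on `g⁻¹(1)`. -/
theorem rational_approximation_of_conjunction [Fintype σ] [Fintype τ] {f : (σ → Bool) → ℤˣ}
    {g : (τ → Bool) → ℤˣ} (hd : thresholdDegree (conjunction f g) ≤ d) {a : ℝ} (ha : 0 < a) :
    (∃ p ∈ lowDegree σ d, ∃ q ∈ lowDegree σ d, ∀ x, 0 < q x ∧
      a * q x ≤ ((f x : ℤ) : ℝ) * p x ∧ ((f x : ℤ) : ℝ) * p x ≤ q x) ∨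
    (∃ P ∈ lowDegree τ (2 * d), ∃ Q ∈ lowDegree τ (2 * d), ∀ y, 0 ≤ P y ∧ 0 ≤ Q y ∧
      (g y = 1 → P y ≤ 2 * a ^ 2 * Q y ∧ 0 < Q y) ∧ (g y = -1 → Q y ≤ 2 * P y ∧ 0 < P y)) := by
  classical
  obtain ⟨φ, hφ, hs⟩ := thresholdDegree_le_iff.1 hd
  rw [signRepresents_conjunction_iff] at hs
  set F : (σ → Bool) → ℝ := fun x => ((f x : ℤ) : ℝ) with hF
  set Φ : (σ → Bool) → (τ → Bool) → ℝ := fun x y => φ (Sum.elim x y) with hΦ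
  have hgne : ∀ y, g y = -1 ∨ g y = 1 := fun y => (Int.units_eq_one_or (g y)).symm
  have hpos : ∀ x y, g y = 1 → 0 < Φ x y := fun x y h => (hs x y).2 (by simp [h])
  have hneg : ∀ x y, g y = -1 → 0 < F x * Φ x y := by
    intro x y h
    rcases Int.units_eq_one_or (f x) with hf | hf
    · have := (hs x y).2 (by simp [hf])
      simpa [hF, hf] using this
    · have := (hs x y).1 ⟨hf, h⟩
      simpa [hF, hf] using this
  -- Let `p` mix the columns with `g y = -1` and `q` those with `g y = 1`. The two copies of the
  -- `x`-cube encode the inequalities `a q ≤ F p` and `F p ≤ q`.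
  let A : (σ → Bool) ⊕ (σ → Bool) → (τ → Bool) → ℝ := fun i y =>
    if g y = -1 then Sum.elim (fun x => F x * Φ x y) (fun x => -(F x * Φ x y)) i
    else Sum.elim (fun x => -(a * Φ x y)) (fun x => Φ x y) i
  rcases ville_alternative A with ⟨w, hw0, hw1, hw⟩ | ⟨u, hu0, hu⟩
  · left
    let p : (σ → Bool) → ℝ := fun x => ∑ y, w y * if g y = -1 then Φ x y else 0
    let q : (σ → Bool) → ℝ := fun x => ∑ y, w y * if g y = -1 then 0 else Φ x y
    have hp : p ∈ lowDegree σ d := by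
      have : p = ∑ y, (w y * if g y = -1 then 1 else 0) • fun x => Φ x y := by
        funext x
        simp only [p, Finset.sum_apply, Pi.smul_apply, smul_eq_mul]
        exact Finset.sum_congr rfl fun y _ => by split_ifs <;> ring
      rw [this]
      exact Submodule.sum_mem _ fun y _ => Submodule.smul_mem _ _ (lowDegree_elim_left hφ y)
    have hq : q ∈ lowDegree σ d := by
      have : q = ∑ y, (w y * if g y = -1 then 0 else 1) • fun x => Φ x y := by
        funext x
        simp only [q, Finset.sum_apply, Pi.smul_apply, smul_eq_mul]
        exact Finset.sum_congr rfl fun y _ => by split_ifs <;> ring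
      rw [this]
      exact Submodule.sum_mem _ fun y _ => Submodule.smul_mem _ _ (lowDegree_elim_left hφ y)
    have h1 : ∀ x, a * q x ≤ F x * p x := by
      intro x
      have h := hw (Sum.inl x)
      have : ∑ y, w y * A (Sum.inl x) y = F x * p x - a * q x := by
        simp only [p, q, Finset.mul_sum, ← Finset.sum_sub_distrib]
        refine Finset.sum_congr rfl fun y _ => ?_
        simp only [A]
        split_ifs <;> simp <;> ring
      linarith
    have h2 : ∀ x, F x * p x ≤ q x := by
      intro x
      have h := hw (Sum.inr x)
      have : ∑ y, w y * A (Sum.inr x) y = q x - F x * p x := by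
        simp only [p, q, Finset.mul_sum, ← Finset.sum_sub_distrib]
        refine Finset.sum_congr rfl fun y _ => ?_
        simp only [A]
        split_ifs
        · simp; ring
        · simp
      linarith
    refine ⟨p, hp, q, hq, fun x => ⟨?_, h1 x, h2 x⟩⟩
    -- If `q x` vanished, so would `p x`; all terms of `q x` and `F x * p x` are nonnegative, so
    -- every weight would be zero.
    by_contra hq0
    have hqn : ∀ y, 0 ≤ w y * if g y = -1 then 0 else Φ x y := fun y => by
      refine mul_nonneg (hw0 y) ?_
      split_ifs with h
      · exact le_rfl
      · exact (hpos x y ((hgne y).resolve_left h)).le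
    have hqz : q x = 0 := le_antisymm (not_lt.1 hq0) (Finset.sum_nonneg fun y _ => hqn y)
    have hpz : F x * p x = 0 := le_antisymm (by linarith [h2 x]) (by nlinarith [h1 x])
    have hpn : ∀ y, 0 ≤ w y * if g y = -1 then F x * Φ x y else 0 := fun y => by
      refine mul_nonneg (hw0 y) ?_
      split_ifs with h
      · exact (hneg x y h).le
      · exact le_rfl
    have hpe : F x * p x = ∑ y, w y * if g y = -1 then F x * Φ x y else 0 := by
      simp only [p, Finset.mul_sum]
      refine Finset.sum_congr rfl fun y _ => ?_
      split_ifs <;> ring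
    have hz1 := (Finset.sum_eq_zero_iff_of_nonneg fun y _ => hqn y).1 hqz
    have hz2 := (Finset.sum_eq_zero_iff_of_nonneg fun y _ => hpn y).1 (hpe ▸ hpz)
    have : ∀ y, w y = 0 := by
      intro y
      rcases hgne y with h | h
      · have := hz2 y (Finset.mem_univ _)
        rw [if_pos h] at this
        exact (mul_eq_zero.1 this).resolve_right (hneg x y h).ne'
      · have := hz1 y (Finset.mem_univ _)
        rw [if_neg (by rw [h]; decide)] at this
        exact (mul_eq_zero.1 this).resolve_right (hpos x y h).ne'
    simp [this] at hw1
  · right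
    -- Splitting by the value of `f` gives sums of known sign: for `v ≥ 0`, `∑ v |Φ|` is `S v 1 + S
    -- v (-1)` where `g y = 1` and `S v 1 - S v (-1)` where `g y = -1`. In both cases `(S v 1)² + (S
    -- v (-1))²` equals the square of `∑ v |Φ|` up to a factor `2`, and it is a polynomial.
    let S : ((σ → Bool) → ℝ) → ℤˣ → (τ → Bool) → ℝ := fun v c y =>
      ∑ x, v x * if f x = c then Φ x y else 0
    have hS : ∀ v c, S v c ∈ lowDegree τ d := by
      intro v c
      have : S v c = ∑ x, (v x * if f x = c then 1 else 0) • fun y => Φ x y := by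
        funext y
        simp only [S, Finset.sum_apply, Pi.smul_apply, smul_eq_mul]
        exact Finset.sum_congr rfl fun x _ => by split_ifs <;> ring
      rw [this]
      exact Submodule.sum_mem _ fun y _ => Submodule.smul_mem _ _ (lowDegree_elim_right hφ y)
    have hsum : ∀ v y, S v 1 y + S v (-1) y = ∑ x, v x * Φ x y := by
      intro v y
      simp only [S, ← Finset.sum_add_distrib]
      refine Finset.sum_congr rfl fun x _ => ?_
      rcases Int.units_eq_one_or (f x) with h | h
      · rw [if_pos h, if_neg (by rw [h]; decide)]; ring
      · rw [if_pos h, if_neg (by rw [h]; decide)]; ring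
    have hsub : ∀ v y, S v 1 y - S v (-1) y = ∑ x, v x * (F x * Φ x y) := by
      intro v y
      simp only [S, ← Finset.sum_sub_distrib]
      refine Finset.sum_congr rfl fun x _ => ?_
      rcases Int.units_eq_one_or (f x) with h | h
      · rw [if_pos h, if_neg (by rw [h]; decide)]; simp [hF, h]
      · rw [if_pos h, if_neg (by rw [h]; decide)]; simp [hF, h]
    have hnn : ∀ v, (∀ x, 0 ≤ v x) → ∀ c y, g y = 1 → 0 ≤ S v c y := by
      intro v hv c y hy
      refine Finset.sum_nonneg fun x _ => mul_nonneg (hv x) ?_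
      split_ifs
      · exact (hpos x y hy).le
      · exact le_rfl
    have hn1 : ∀ v, (∀ x, 0 ≤ v x) → ∀ y, g y = -1 → 0 ≤ S v 1 y := by
      intro v hv y hy
      refine Finset.sum_nonneg fun x _ => mul_nonneg (hv x) ?_
      split_ifs with h
      · have := hneg x y hy
        simp only [hF, h] at this
        simpa using this.le
      · exact le_rfl
    have hn2 : ∀ v, (∀ x, 0 ≤ v x) → ∀ y, g y = -1 → S v (-1) y ≤ 0 := by
      intro v hv y hy
      refine Finset.sum_nonpos fun x _ => mul_nonpos_of_nonneg_of_nonpos (hv x) ?_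
      split_ifs with h
      · have := hneg x y hy
        simp only [hF, h] at this
        simpa using this.le
      · exact le_rfl
    set U : (σ → Bool) → ℝ := fun x => u (Sum.inl x) with hU
    set V : (σ → Bool) → ℝ := fun x => u (Sum.inr x) with hV
    have hsq : ∀ v, S v 1 ^ 2 + S v (-1) ^ 2 ∈ lowDegree τ (2 * d) := fun v => by
      rw [mul_comm]
      exact Submodule.add_mem _ (lowDegree_pow (hS _ _) 2) (lowDegree_pow (hS _ _) 2)
    refine ⟨_, hsq V, _, hsq U, fun y => ⟨?_, ?_, fun hy => ?_, fun hy => ?_⟩⟩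
    · simp only [Pi.add_apply, Pi.pow_apply]; positivity
    · simp only [Pi.add_apply, Pi.pow_apply]; positivity
    · have h := hu y
      rw [Fintype.sum_sum_type] at h
      simp only [A, if_neg (show ¬ g y = -1 by rw [hy]; decide), Sum.elim_inl, Sum.elim_inr] at h
      have e1 : ∑ x, u (Sum.inl x) * -(a * Φ x y) = -(a * (S U 1 y + S U (-1) y)) := by
        rw [hsum, Finset.mul_sum, ← Finset.sum_neg_distrib]
        exact Finset.sum_congr rfl fun x _ => by simp only [hU]; ring
      have e2 : ∑ x, u (Sum.inr x) * Φ x y = S V 1 y + S V (-1) y := (hsum V y).symm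
      rw [e1, e2] at h
      have a1 := hnn U (fun x => hu0 _) 1 y hy
      have a2 := hnn U (fun x => hu0 _) (-1) y hy
      have a3 := hnn V (fun x => hu0 _) 1 y hy
      have a4 := hnn V (fun x => hu0 _) (-1) y hy
      simp only [Pi.add_apply, Pi.pow_apply]
      have hUp : 0 < S U 1 y + S U (-1) y := by
        by_contra hc
        nlinarith
      constructor
      · have h3 : (S V 1 y + S V (-1) y) ^ 2 ≤ (a * (S U 1 y + S U (-1) y)) ^ 2 :=
          pow_le_pow_left₀ (by positivity) (by linarith) 2
        have h4 : a ^ 2 * (S U 1 y - S U (-1) y) ^ 2 ≥ 0 := by positivity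
        nlinarith [mul_nonneg a3 a4]
      · by_contra hc
        nlinarith [sq_nonneg (S U 1 y), sq_nonneg (S U (-1) y), mul_pos hUp hUp,
          sq_nonneg (S U 1 y - S U (-1) y)]
    · have h := hu y
      rw [Fintype.sum_sum_type] at h
      simp only [A, if_pos hy, Sum.elim_inl, Sum.elim_inr] at h
      have e1 : ∑ x, u (Sum.inl x) * (F x * Φ x y) = S U 1 y - S U (-1) y := (hsub U y).symm
      have e2 : ∑ x, u (Sum.inr x) * -(F x * Φ x y) = -(S V 1 y - S V (-1) y) := by
        rw [hsub, ← Finset.sum_neg_distrib]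
        exact Finset.sum_congr rfl fun x _ => by simp only [hV]; ring
      rw [e1, e2] at h
      have a1 := hn1 U (fun x => hu0 _) y hy
      have a2 := hn2 U (fun x => hu0 _) y hy
      have a3 := hn1 V (fun x => hu0 _) y hy
      have a4 := hn2 V (fun x => hu0 _) y hy
      simp only [Pi.add_apply, Pi.pow_apply]
      have h3 : (S U 1 y - S U (-1) y) ^ 2 ≤ (S V 1 y - S V (-1) y) ^ 2 :=
        pow_le_pow_left₀ (by linarith) (by linarith) 2
      have hVp : 0 < S V 1 y - S V (-1) y := by linarith
      constructor
      · nlinarith [mul_nonneg a1 (neg_nonneg.2 a2), sq_nonneg (S V 1 y + S V (-1) y)]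
      · nlinarith [mul_pos hVp hVp, sq_nonneg (S V 1 y + S V (-1) y)]

end Conjunction

/-! ### Real polynomials on geometric progressions of integers -/

/-- The influence of a root `z` on the values of a polynomial on `t ≤ |v| ≤ B t`. -/
noncomputable def annulusWeight (B t : ℝ) (z : ℂ) : ℝ := min 1 (min (‖z‖ / t) (B * t / ‖z‖))

/-- The total influence of the roots of `P` on its values on `t ≤ |v| ≤ B t`. -/
noncomputable def rootWeight (B t : ℝ) (P : Polynomial ℝ) : ℝ :=
  ((P.aroots ℂ).map (annulusWeight B t)).sum

lemma annulusWeight_nonneg {B t : ℝ} (hB : 0 ≤ B) (ht : 0 ≤ t) (z : ℂ) :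
    0 ≤ annulusWeight B t z := by
  unfold annulusWeight; positivity

lemma rootWeight_nonneg {B t : ℝ} (hB : 0 ≤ B) (ht : 0 ≤ t) (P : Polynomial ℝ) :
    0 ≤ rootWeight B t P := by
  refine Multiset.sum_nonneg fun w hw => ?_
  obtain ⟨z, -, rfl⟩ := Multiset.mem_map.1 hw
  exact annulusWeight_nonneg hB ht z

/-- As the annulus moves outwards the weight grows geometrically until it meets `‖z‖` and then
decays geometrically. The two tails give at most `2` each, the crossing at most `1`. -/
lemma sum_annulusWeight_le {B t : ℝ} (hB : 2 ≤ B) (ht : 0 < t) (J : ℕ) (z : ℂ) :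
    ∑ j ∈ Finset.range J, annulusWeight B (B ^ j * t) z ≤ 5 := by
  have hB0 : 0 < B := by linarith
  rcases eq_or_ne z 0 with rfl | hz
  · simp [annulusWeight]
  set y : ℝ := ‖z‖ / t with hy
  have hz' : 0 < ‖z‖ := norm_pos_iff.2 hz
  have hy0 : 0 < y := div_pos hz' ht
  have hw : ∀ j : ℕ, annulusWeight B (B ^ j * t) z = min 1 (min (y / B ^ j) (B * (B ^ j / y))) := by
    intro j
    unfold annulusWeight
    congr 2
    · rw [hy, mul_comm, div_div]
    · rw [hy]; field_simp
  -- Inductive form of the bound: after the crossing, `2 * (y / B ^ J)` is held in reserve for the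
  -- remaining tail.
  have key : ∀ J : ℕ,
      (B ^ J ≤ y → ∑ j ∈ Finset.range J, annulusWeight B (B ^ j * t) z ≤ 2 * (B ^ J / y)) ∧
      (y < B ^ J → ∑ j ∈ Finset.range J, annulusWeight B (B ^ j * t) z ≤ 5 - 2 * (y / B ^ J)) := by
    intro J
    induction J with
    | zero =>
      constructor
      · intro _
        simp only [Finset.range_zero, Finset.sum_empty]; positivity
      · intro h
        simp only [Finset.range_zero, Finset.sum_empty, pow_zero, div_one] at h ⊢; linarith
    | succ J ih =>
      have hBJ : 0 < B ^ J := by positivity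
      have hr : 0 < B ^ J / y := by positivity
      have hr' : 0 < y / B ^ J := by positivity
      have e1 : B ^ (J + 1) / y = B * (B ^ J / y) := by rw [pow_succ]; ring
      have e2 : y / B ^ (J + 1) = (y / B ^ J) / B := by
        rw [pow_succ]; exact (div_div _ _ _).symm
      have e3 : (y / B ^ J) / B ≤ (y / B ^ J) / 2 := div_le_div_of_nonneg_left hr'.le two_pos hB
      have hle : B ^ J ≤ B ^ (J + 1) := pow_le_pow_right₀ (by linarith) (by omega)
      rw [Finset.sum_range_succ, hw J, e1, e2]
      constructor
      · intro h
        have := ih.1 (hle.trans h)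
        have h2 : min 1 (min (y / B ^ J) (B * (B ^ J / y))) ≤ B * (B ^ J / y) :=
          (min_le_right _ _).trans (min_le_right _ _)
        nlinarith
      · intro h
        rcases le_or_gt (B ^ J) y with h1 | h1
        · have := ih.1 h1
          have h2 : min 1 (min (y / B ^ J) (B * (B ^ J / y))) ≤ 1 := min_le_left _ _
          have h3 : B ^ J / y ≤ 1 := (div_le_one hy0).2 h1
          have h4 : y / B ^ J / B ≤ 1 := by
            rw [← e2]; exact (div_le_one (by positivity)).2 h.le
          linarith
        · have := ih.2 h1
          have h2 : min 1 (min (y / B ^ J) (B * (B ^ J / y))) ≤ y / B ^ J :=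
            (min_le_right _ _).trans (min_le_left _ _)
          linarith
  rcases le_or_gt (B ^ J) y with h1 | h1
  · have := (key J).1 h1
    have h3 : B ^ J / y ≤ 1 := (div_le_one hy0).2 h1
    linarith
  · have := (key J).2 h1
    have hr' : 0 < y / B ^ J := by positivity
    linarith

lemma card_aroots_le (P : Polynomial ℝ) : (P.aroots ℂ).card ≤ P.natDegree :=
  (Polynomial.card_roots' _).trans Polynomial.natDegree_map_le

/-- By pigeonhole, one of `J` scales has root weight at most `5 deg P / J`. -/
lemma sum_rootWeight_le {B t : ℝ} (hB : 2 ≤ B) (ht : 0 < t) (J : ℕ) (P : Polynomial ℝ) :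
    ∑ j ∈ Finset.range J, rootWeight B (B ^ j * t) P ≤ 5 * P.natDegree := by
  have : ∀ s : Multiset ℂ, ∑ j ∈ Finset.range J, (s.map (annulusWeight B (B ^ j * t))).sum ≤
      5 * s.card := by
    intro s
    induction s using Multiset.induction_on with
    | empty => simp
    | cons z s ih =>
      simp only [Multiset.map_cons, Multiset.sum_cons, Finset.sum_add_distrib, Multiset.card_cons]
      push_cast
      linarith [sum_annulusWeight_le hB ht J z]
  refine (this _).trans ?_
  have := card_aroots_le P
  gcongr

lemma eval_eq_prod_aroots (P : Polynomial ℝ) (v : ℝ) : ((P.eval v : ℝ) : ℂ) =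
    P.leadingCoeff * ((P.aroots ℂ).map fun z => (v : ℂ) - z).prod := by
  have h := (IsAlgClosed.splits (P.map (algebraMap ℝ ℂ))).aeval_eq_prod_aroots (v : ℂ)
  rw [← Complex.coe_algebraMap, ← Polynomial.aeval_algebraMap_apply_eq_algebraMap_eval]
  exact h

/-- Replace `v - z` by `v` for roots inside the annulus and by `-z` for roots beyond it; the
relative error is at most the weight, and errors accumulate as `∏ (1 + ω) ≤ exp (∑ ω)`. Weight below
`1` excludes roots in the annulus itself. -/
lemma exists_monomial_approx {B t : ℝ} (ht : 0 < t) (hB : 0 < B) (s : Multiset ℂ)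
    (hs : ∀ z ∈ s, annulusWeight B t z < 1) : ∃ (e : ℕ) (c : ℂ), c ≠ 0 ∧
      ∀ v : ℂ, t ≤ ‖v‖ → ‖v‖ ≤ B * t → ‖(s.map fun z => v - z).prod - c * v ^ e‖ ≤
        (Real.exp (s.map (annulusWeight B t)).sum - 1) * ‖c * v ^ e‖ := by
  induction s using Multiset.induction_on with
  | empty => exact ⟨0, 1, one_ne_zero, by simp⟩
  | cons z s ih =>
    obtain ⟨e, c, hc, h⟩ := ih fun w hw => hs w (Multiset.mem_cons_of_mem hw)
    have hz := hs z (Multiset.mem_cons_self z s)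
    have hW : 0 ≤ (s.map (annulusWeight B t)).sum := by
      refine Multiset.sum_nonneg fun w hw => ?_
      obtain ⟨z, -, rfl⟩ := Multiset.mem_map.1 hw
      exact annulusWeight_nonneg hB.le ht.le z
    obtain ⟨e', c', hc', h'⟩ : ∃ (e' : ℕ) (c' : ℂ), c' ≠ 0 ∧ ∀ v : ℂ, t ≤ ‖v‖ → ‖v‖ ≤ B * t →
        ‖(v - z) - c' * v ^ e'‖ ≤ annulusWeight B t z * ‖c' * v ^ e'‖ := by
      rcases lt_or_ge (‖z‖ / t) 1 with h1 | h1
      · refine ⟨1, 1, one_ne_zero, fun v hv hv' => ?_⟩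
        have hBt : t ≤ B * t := hv.trans hv'
        have hwt : annulusWeight B t z = ‖z‖ / t := by
          unfold annulusWeight
          rcases eq_or_ne z 0 with rfl | hz0
          · simp
          have h2 : 1 ≤ B * t / ‖z‖ := by
            rw [one_le_div (norm_pos_iff.2 hz0)]
            rw [div_lt_one ht] at h1
            linarith
          rw [min_eq_left (h1.le.trans h2), min_eq_right h1.le]
        rw [hwt, one_mul, pow_one, sub_sub_cancel_left, norm_neg, div_mul_eq_mul_div, le_div_iff₀ ht]
        exact mul_le_mul_of_nonneg_left hv (norm_nonneg z)
      · have hz0 : 0 < ‖z‖ := by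
          by_contra hcon
          have : ‖z‖ = 0 := le_antisymm (not_lt.1 hcon) (norm_nonneg z)
          rw [this, zero_div] at h1; linarith
        have hwt : annulusWeight B t z = B * t / ‖z‖ := by
          unfold annulusWeight at hz ⊢
          simp only [min_lt_iff, lt_irrefl, false_or] at hz
          have hlt := hz.resolve_left (not_lt.2 h1)
          rw [min_eq_right (hlt.le.trans h1), min_eq_right hlt.le]
        refine ⟨0, -z, neg_ne_zero.2 (norm_pos_iff.1 hz0), fun v hv hv' => ?_⟩
        rw [hwt, pow_zero, mul_one, norm_neg, div_mul_cancel₀ _ hz0.ne']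
        simpa using hv'
    refine ⟨e' + e, c' * c, mul_ne_zero hc' hc, fun v hv hv' => ?_⟩
    have a1 := h v hv hv'
    have a2 := h' v hv hv'
    simp only [Multiset.map_cons, Multiset.prod_cons, Multiset.sum_cons]
    set p := (s.map fun z => v - z).prod
    set A := c * v ^ e
    set A' := c' * v ^ e'
    have e1 : c' * c * v ^ (e' + e) = A' * A := by simp only [A, A']; ring
    rw [e1, norm_mul, Real.exp_add]
    set ω := annulusWeight B t z
    set W := (s.map (annulusWeight B t)).sum
    have e2 : (v - z) * p - A' * A = ((v - z) - A') * A + ((v - z) - A') * (p - A) + A' * (p - A) := by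
      ring
    have hω : ω + 1 ≤ Real.exp ω := Real.add_one_le_exp ω
    have hW1 : 1 ≤ Real.exp W := Real.one_le_exp hW
    have hω0 : 0 ≤ ω := annulusWeight_nonneg hB.le ht.le z
    calc ‖(v - z) * p - A' * A‖ ≤ ‖(v - z) - A'‖ * ‖A‖ + ‖(v - z) - A'‖ * ‖p - A‖ + ‖A'‖ * ‖p - A‖ := by
          rw [e2]
          refine (norm_add₃_le).trans ?_
          simp only [norm_mul]; exact le_rfl
      _ ≤ (ω * ‖A'‖) * ‖A‖ + (ω * ‖A'‖) * ((Real.exp W - 1) * ‖A‖) +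
          ‖A'‖ * ((Real.exp W - 1) * ‖A‖) := by gcongr
      _ = ((ω + 1) * Real.exp W - 1) * (‖A'‖ * ‖A‖) := by ring
      _ ≤ _ := by gcongr

/-- On an annulus that is far from its roots, a real polynomial behaves like a monomial. -/
lemma exists_monomial_bounds {B t : ℝ} (ht : 0 < t) (hB : 0 < B) {P : Polynomial ℝ} (hP : P ≠ 0)
    (hw : rootWeight B t P ≤ 1 / 10) : ∃ (e : ℕ) (K : ℝ), 0 < K ∧ ∀ v : ℝ, t ≤ v → v ≤ B * t →
      7 / 8 * (K * v ^ e) ≤ |P.eval v| ∧ |P.eval v| ≤ 9 / 8 * (K * v ^ e) ∧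
      |P.eval (-v) - (-1) ^ e * P.eval v| ≤ 1 / 4 * (K * v ^ e) := by
  have hlt : ∀ z ∈ P.aroots ℂ, annulusWeight B t z < 1 := by
    intro z hz
    refine lt_of_le_of_lt (le_trans ?_ hw) (by norm_num : (1 : ℝ) / 10 < 1)
    refine Multiset.single_le_sum (fun w hw => ?_) _ (Multiset.mem_map_of_mem _ hz)
    obtain ⟨z, -, rfl⟩ := Multiset.mem_map.1 hw
    exact annulusWeight_nonneg hB.le ht.le z
  obtain ⟨e, c, hc, h⟩ := exists_monomial_approx ht hB _ hlt
  have hlc : (P.leadingCoeff : ℂ) ≠ 0 := by simpa using hP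
  set k : ℂ := P.leadingCoeff * c with hk
  have hexp : Real.exp (rootWeight B t P) - 1 ≤ 1 / 8 := by
    have h1 : Real.exp (rootWeight B t P) ≤ Real.exp (1 / 10) := Real.exp_le_exp.2 hw
    -- From `1 - x ≤ exp (-x)` one gets `exp (1 / 10) ≤ 10 / 9`.
    have h2 : Real.exp (1 / 10) ≤ 9 / 8 := by
      have := Real.add_one_le_exp (-(1 / 10) : ℝ)
      rw [Real.exp_neg] at this
      have hp := Real.exp_pos (1 / 10)
      have h3 : (9 / 10 : ℝ) ≤ (Real.exp (1 / 10))⁻¹ := by linarith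
      rw [le_inv_comm₀ (by norm_num) hp] at h3
      norm_num at h3 ⊢; linarith
    linarith
  -- The same monomial serves at `v` and `-v`, which ties the parity of `e` to the signs there.
  have hkey : ∀ v : ℝ, t ≤ |v| → |v| ≤ B * t →
      ‖((P.eval v : ℝ) : ℂ) - k * (v : ℂ) ^ e‖ ≤ 1 / 8 * (‖k‖ * |v| ^ e) := by
    intro v h1 h2
    have := h v (by simpa using h1) (by simpa using h2)
    rw [eval_eq_prod_aroots, hk, mul_assoc, ← mul_sub, norm_mul]
    have e1 : ‖(P.leadingCoeff : ℂ) * c‖ * |v| ^ e = ‖(P.leadingCoeff : ℂ)‖ * ‖c * (v : ℂ) ^ e‖ := by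
      simp [mul_assoc]
    rw [e1, mul_left_comm]
    refine mul_le_mul_of_nonneg_left (this.trans ?_) (norm_nonneg _)
    exact mul_le_mul_of_nonneg_right hexp (norm_nonneg _)
  refine ⟨e, ‖k‖, norm_pos_iff.2 (mul_ne_zero hlc hc), fun v hv hv' => ?_⟩
  have hv0 : 0 < v := ht.trans_le hv
  have b1 := hkey v (by rwa [abs_of_pos hv0]) (by rwa [abs_of_pos hv0])
  have b2 := hkey (-v) (by rwa [abs_neg, abs_of_pos hv0]) (by rwa [abs_neg, abs_of_pos hv0])
  rw [abs_neg] at b2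
  rw [abs_of_pos hv0] at b1 b2
  have hn : ‖k * (v : ℂ) ^ e‖ = ‖k‖ * v ^ e := by simp [abs_of_pos hv0]
  have hPn : ‖((P.eval v : ℝ) : ℂ)‖ = |P.eval v| := by simp
  refine ⟨?_, ?_, ?_⟩
  · have := norm_sub_norm_le (k * (v : ℂ) ^ e) ((P.eval v : ℝ) : ℂ)
    rw [norm_sub_rev, hn, hPn] at this
    linarith
  · have := norm_sub_norm_le ((P.eval v : ℝ) : ℂ) (k * (v : ℂ) ^ e)
    rw [hn, hPn] at this
    linarith
  · have e1 : ((P.eval (-v) - (-1) ^ e * P.eval v : ℝ) : ℂ) =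
        (((P.eval (-v) : ℝ) : ℂ) - k * ((-v : ℝ) : ℂ) ^ e) -
          (-1) ^ e * (((P.eval v : ℝ) : ℂ) - k * (v : ℂ) ^ e) := by
      push_cast
      rw [neg_pow (v : ℂ)]; ring
    have e2 : |P.eval (-v) - (-1) ^ e * P.eval v| =
        ‖((P.eval (-v) - (-1) ^ e * P.eval v : ℝ) : ℂ)‖ := by rw [Complex.norm_real]; rfl
    rw [e2, e1]
    refine (norm_sub_le _ _).trans ?_
    rw [norm_mul, norm_pow, norm_neg, norm_one, one_pow, one_mul]
    linarith

/-- A quotient of polynomials of degree at most `d` cannot approximate the sign function within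
a ratio `a` on `100 d` steps of a geometric progression of ratio at least `2 / a`. -/
theorem not_sign_approximation {d J : ℕ} {P Q : Polynomial ℝ} (hP : P.natDegree ≤ d)
    (hQ : Q.natDegree ≤ d) {a B : ℝ} (ha : 0 < a) (hB : 2 ≤ B) (haB : 2 ≤ a * B) (hJ : 0 < J)
    (hJd : 100 * d ≤ J)
    (h : ∀ j ≤ J, 0 < Q.eval (B ^ j) ∧ a * Q.eval (B ^ j) ≤ P.eval (B ^ j) ∧
      P.eval (B ^ j) ≤ Q.eval (B ^ j))
    (h' : ∀ j ≤ J, 0 < Q.eval (-B ^ j) ∧ a * Q.eval (-B ^ j) ≤ -P.eval (-B ^ j)) : False := by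
  have hB0 : 0 < B := by linarith
  -- Over all scales the two polynomials have total weight at most `10 d ≤ J / 10`.
  obtain ⟨j, hj, hw⟩ : ∃ j ∈ Finset.range J,
      rootWeight B (B ^ j * 1) P + rootWeight B (B ^ j * 1) Q ≤ 1 / 10 := by
    refine Finset.exists_le_of_sum_le (by simpa using hJ.ne') ?_
    rw [Finset.sum_add_distrib, Finset.sum_const, Finset.card_range, nsmul_eq_mul]
    have h1 := sum_rootWeight_le hB one_pos J P
    have h2 := sum_rootWeight_le hB one_pos J Q
    have h3 : (P.natDegree : ℝ) ≤ d := by exact_mod_cast hP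
    have h4 : (Q.natDegree : ℝ) ≤ d := by exact_mod_cast hQ
    have h5 : (100 * d : ℝ) ≤ J := by exact_mod_cast hJd
    linarith
  rw [mul_one] at hw
  have hj' : j + 1 ≤ J := by simpa using hj
  obtain ⟨q1, p1, p1'⟩ := h j (by omega)
  obtain ⟨q2, p2, p2'⟩ := h (j + 1) hj'
  obtain ⟨q3, p3⟩ := h' j (by omega)
  have ht : 0 < B ^ j := by positivity
  have hP0 : P ≠ 0 := by
    rintro rfl; simp only [Polynomial.eval_zero] at p1; nlinarith
  have hQ0 : Q ≠ 0 := by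
    rintro rfl; simp at q1
  have w1 := rootWeight_nonneg hB0.le ht.le P
  have w2 := rootWeight_nonneg hB0.le ht.le Q
  obtain ⟨e, K, hK, hPe⟩ := exists_monomial_bounds ht hB0 hP0 (by linarith)
  obtain ⟨e', K', hK', hQe⟩ := exists_monomial_bounds ht hB0 hQ0 (by linarith)
  have htB : B ^ j ≤ B * B ^ j := le_mul_of_one_le_left ht.le (by linarith)
  rw [pow_succ'] at q2 p2 p2'
  obtain ⟨P1, P2, P3⟩ := hPe _ le_rfl htB
  obtain ⟨P1', P2', -⟩ := hPe _ htB le_rfl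
  obtain ⟨Q1, Q2, Q3⟩ := hQe _ le_rfl htB
  obtain ⟨Q1', Q2', -⟩ := hQe _ htB le_rfl
  rw [mul_pow] at P1' P2' Q1' Q2'
  set t := B ^ j
  have r1 : 0 < P.eval t := by nlinarith
  have r2 : 0 < P.eval (B * t) := by nlinarith
  have r3 : P.eval (-t) < 0 := by nlinarith
  rw [abs_of_pos r1] at P1 P2
  rw [abs_of_pos r2] at P1' P2'
  rw [abs_of_pos q1] at Q1 Q2
  rw [abs_of_pos q2] at Q1' Q2'
  have hKe : 0 < K * t ^ e := by positivity
  have hKe' : 0 < K' * t ^ e' := by positivity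
  -- `P` changes sign between `t` and `-t` and `Q` does not, so the two exponents have different
  -- parity.
  have odd_e : Odd e := by
    by_contra hcon
    rw [Nat.not_odd_iff_even] at hcon
    rw [hcon.neg_one_pow, one_mul, abs_le] at P3
    linarith [P3.1]
  have even_e' : Even e' := by
    by_contra hcon
    rw [Nat.not_even_iff_odd] at hcon
    rw [hcon.neg_one_pow, abs_le] at Q3
    linarith [Q3.2]
  have hne : e ≠ e' := fun he => (Nat.not_even_iff_odd.2 odd_e) (he ▸ even_e')
  set X := K * t ^ e
  set Y := K' * t ^ e'
  have eX : K * (B ^ e * t ^ e) = B ^ e * X := by simp only [X]; ring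
  have eY : K' * (B ^ e' * t ^ e') = B ^ e' * Y := by simp only [Y]; ring
  rw [eX] at P1' P2'
  rw [eY] at Q1' Q2'
  have hBe : 0 < B ^ e := by positivity
  have hBe' : 0 < B ^ e' := by positivity
  -- From `t` to `B t` the quotient of the monomials changes by a factor of at least `B`, up or
  -- down. The approximations lose only `(9/7)² < 2`, so `P / Q` cannot stay in `[a, 1]` when `a B ≥
  -- 2`.
  rcases lt_or_gt_of_ne hne with hlt | hlt
  · have hpow : B * B ^ e ≤ B ^ e' := by
      rw [← pow_succ']; exact pow_le_pow_right₀ (by linarith) hlt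
    have s1 : a * (7 / 8 * (B ^ e' * Y)) ≤ 9 / 8 * (B ^ e * X) :=
      (mul_le_mul_of_nonneg_left Q1' ha.le).trans (p2.trans P2')
    have s2 : 7 / 8 * X ≤ 9 / 8 * Y := P1.trans (p1'.trans Q2)
    have s3 : 2 * B ^ e ≤ a * B ^ e' := by
      calc 2 * B ^ e ≤ (a * B) * B ^ e := by gcongr
        _ = a * (B * B ^ e) := by ring
        _ ≤ _ := by gcongr
    have s4 : 2 * B ^ e * Y ≤ a * B ^ e' * Y := mul_le_mul_of_nonneg_right s3 hKe'.le
    have s5 : B ^ e * (7 / 8 * X) ≤ B ^ e * (9 / 8 * Y) := mul_le_mul_of_nonneg_left s2 hBe.le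
    nlinarith [mul_pos hBe hKe']
  · have hpow : B * B ^ e' ≤ B ^ e := by
      rw [← pow_succ']; exact pow_le_pow_right₀ (by linarith) hlt
    have s1 : 7 / 8 * (B ^ e * X) ≤ 9 / 8 * (B ^ e' * Y) := P1'.trans (p2'.trans Q2')
    have s2 : a * (7 / 8 * Y) ≤ 9 / 8 * X :=
      (mul_le_mul_of_nonneg_left Q1 ha.le).trans (p1.trans P2)
    have s3 : 2 * B ^ e' ≤ a * B ^ e := by
      calc 2 * B ^ e' ≤ (a * B) * B ^ e' := by gcongr
        _ = a * (B * B ^ e') := by ring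
        _ ≤ _ := by gcongr
    have s4 : 2 * B ^ e' * Y ≤ a * B ^ e * Y := mul_le_mul_of_nonneg_right s3 hKe'.le
    have s5 : B ^ e * (a * (7 / 8 * Y)) ≤ B ^ e * (9 / 8 * X) :=
      mul_le_mul_of_nonneg_left s2 hBe.le
    nlinarith [mul_pos hBe' hKe']

/-! ### Lower bounds for polynomials at integer points -/

/-- A polynomial with leading coefficient `c` and degree `e` is at least `|c| e! / 2 ^ e` at one of
the points `0, …, e`. -/
lemma exists_factorial_le_norm_eval (G : Polynomial ℂ) : ∃ k ≤ G.natDegree,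
    ‖G.leadingCoeff‖ * (G.natDegree.factorial : ℝ) ≤ 2 ^ G.natDegree * ‖G.eval (k : ℂ)‖ := by
  by_contra! hcon
  set e := G.natDegree with he
  -- The `e`-th finite difference is the constant `c e!`, and the absolute values of its binomial
  -- weights sum to `2 ^ e`.
  have h1 := congrFun G.fwdDiff_iter_degree_eq_factorial (0 : ℂ)
  rw [fwdDiff_iter_eq_sum_shift, ← he] at h1
  have h2 : ‖∑ k ∈ Finset.range (e + 1), ((-1 : ℤ) ^ (e - k) * e.choose k) •
      G.eval ((0 : ℂ) + k • (1 : ℂ))‖ = ‖G.leadingCoeff‖ * (e.factorial : ℝ) := by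
    rw [h1]; simp
  have h3 : ‖∑ k ∈ Finset.range (e + 1), ((-1 : ℤ) ^ (e - k) * e.choose k) •
      G.eval ((0 : ℂ) + k • (1 : ℂ))‖ ≤
      ∑ k ∈ Finset.range (e + 1), (e.choose k : ℝ) * ‖G.eval (k : ℂ)‖ := by
    refine (norm_sum_le _ _).trans (le_of_eq (Finset.sum_congr rfl fun k _ => ?_))
    simp
  have h4 : ∑ k ∈ Finset.range (e + 1), (e.choose k : ℝ) * ‖G.eval (k : ℂ)‖ <
      ∑ k ∈ Finset.range (e + 1), (e.choose k : ℝ) *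
        (‖G.leadingCoeff‖ * (e.factorial : ℝ) / 2 ^ e) := by
    refine Finset.sum_lt_sum_of_nonempty (by simp) fun k hk => ?_
    have hk' : k ≤ e := by simpa [Nat.lt_succ_iff] using hk
    have : 0 < e.choose k := Nat.choose_pos hk'
    refine mul_lt_mul_of_pos_left ?_ (by exact_mod_cast this)
    rw [lt_div_iff₀ (by positivity), mul_comm]
    exact hcon k hk'
  have h5 : ∑ k ∈ Finset.range (e + 1), (e.choose k : ℝ) = 2 ^ e := by
    exact_mod_cast Nat.sum_range_choose e
  rw [← Finset.sum_mul, h5, mul_div_cancel₀ _ (by positivity)] at h4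
  linarith

/-- Among the integers of `[t, 2 t]` there is one whose distances to `e ≤ t` given points have a
large product. -/
lemma exists_large_prod_add (s : Multiset ℂ) {t : ℕ} (hs : s.card ≤ t) : ∃ v : ℕ, t ≤ v ∧
    v ≤ 2 * t ∧ (t / 4 : ℝ) ^ s.card * Real.exp (-s.card) ≤
      ‖(s.map fun z => (v : ℂ) + z).prod‖ := by
  rcases Nat.eq_zero_or_pos s.card with h0 | hpos
  · refine ⟨t, le_rfl, by omega, ?_⟩
    rw [Multiset.card_eq_zero.1 h0]; simp
  set e := s.card with he
  -- Sampling `[t, 2t]` with step `m` turns the product into a polynomial in the index `k ≤ e` with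
  -- leading coefficient `m ^ e`, where `m e ≥ t / 2`.
  set m : ℕ := t / e with hm
  have hm1 : 1 ≤ m := (Nat.one_le_div_iff hpos).2 hs
  have hme : m * e ≤ t := Nat.div_mul_le_self t e
  have htm : t ≤ 2 * (m * e) := by
    have := Nat.lt_div_mul_add (a := t) hpos
    nlinarith
  have hmC : (m : ℂ) ≠ 0 := by exact_mod_cast (by omega : m ≠ 0)
  set L : ℂ → Polynomial ℂ := fun z => Polynomial.C (m : ℂ) * Polynomial.X + Polynomial.C ((t : ℂ) + z)
  have hL : ∀ z, (L z).natDegree = 1 := fun z => Polynomial.natDegree_linear hmC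
  have hL' : ∀ z, (L z).leadingCoeff = m := fun z => Polynomial.leadingCoeff_linear hmC
  set G : Polynomial ℂ := (s.map L).prod with hG
  have hdeg : G.natDegree = e := by
    rw [hG, Polynomial.natDegree_multiset_prod]
    · rw [Multiset.map_map, show Polynomial.natDegree ∘ L = fun _ => 1 from funext hL]
      simp [he]
    · intro h
      obtain ⟨z, -, hz⟩ := Multiset.mem_map.1 h
      have := hL z
      rw [hz] at this; simp at this
  have hlead : G.leadingCoeff = (m : ℂ) ^ e := by
    rw [hG, Polynomial.leadingCoeff_multiset_prod, Multiset.map_map,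
      show (fun f : Polynomial ℂ => f.leadingCoeff) ∘ L = fun _ => (m : ℂ) from funext hL']
    simp [he]
  obtain ⟨k, hk, h⟩ := exists_factorial_le_norm_eval G
  rw [hdeg] at hk h
  refine ⟨t + m * k, by omega, ?_, ?_⟩
  · have : m * k ≤ m * e := Nat.mul_le_mul_left m hk
    omega
  have heval : G.eval (k : ℂ) = (s.map fun z => ((t + m * k : ℕ) : ℂ) + z).prod := by
    rw [hG, Polynomial.eval_multiset_prod, Multiset.map_map]
    congr 1
    refine Multiset.map_congr rfl fun z _ => ?_
    simp [L]; ring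
  rw [← heval]
  have hn : ‖G.leadingCoeff‖ = (m : ℝ) ^ e := by rw [hlead]; simp
  rw [hn] at h
  -- `e ^ e / e!` is one term of the series for `exp e`.
  have hexp : (e : ℝ) ^ e * Real.exp (-e) ≤ e.factorial := by
    have := Real.pow_div_factorial_le_exp (x := e) (by positivity) e
    rw [div_le_iff₀ (by positivity)] at this
    rw [Real.exp_neg, ← div_eq_mul_inv, div_le_iff₀ (Real.exp_pos _)]
    linarith
  have htm' : (t / 4 : ℝ) ≤ m * e / 2 := by
    have : (t : ℝ) ≤ 2 * (m * e) := by exact_mod_cast htm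
    linarith
  calc (t / 4 : ℝ) ^ e * Real.exp (-e) ≤ (m * e / 2 : ℝ) ^ e * Real.exp (-e) := by gcongr
    _ = (m : ℝ) ^ e * ((e : ℝ) ^ e * Real.exp (-e)) / 2 ^ e := by
      rw [div_pow, mul_pow]; ring
    _ ≤ (m : ℝ) ^ e * e.factorial / 2 ^ e := by gcongr
    _ ≤ ‖G.eval (k : ℂ)‖ := by
      rw [div_le_iff₀ (by positivity)]; linarith

/-- One of `v`, `z` dominates the other by the factor `1 / ω`, where `ω` is the weight, and `(1 + ω)
/ (1 - ω) ≤ exp (3 ω)` for `ω ≤ 1/2`. -/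
lemma norm_sub_le_exp_mul_norm_add {t : ℝ} (ht : 0 < t) {z v : ℂ} (hv : t ≤ ‖v‖)
    (hv' : ‖v‖ ≤ 2 * t) (hz : annulusWeight 2 t z ≤ 1 / 2) :
    ‖v - z‖ ≤ Real.exp (3 * annulusWeight 2 t z) * ‖v + z‖ := by
  have key : ∀ {x y : ℂ} {ω : ℝ}, 0 ≤ ω → ω ≤ 1 / 2 → ‖y‖ ≤ ω * ‖x‖ →
      ‖x - y‖ ≤ Real.exp (3 * ω) * ‖x + y‖ := by
    intro x y ω h0 h1 h
    have a1 : ‖x - y‖ ≤ ‖x‖ + ‖y‖ := norm_sub_le x y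
    have a2 : ‖x‖ - ‖y‖ ≤ ‖x + y‖ := by
      have := norm_sub_norm_le x (-y)
      rwa [norm_neg, sub_neg_eq_add] at this
    have a3 : 3 * ω + 1 + (3 * ω) ^ 2 / 2 ≤ Real.exp (3 * ω) := by
      have := Real.quadratic_le_exp_of_nonneg (x := 3 * ω) (by positivity)
      linarith
    have a4 : (1 + ω) ≤ Real.exp (3 * ω) * (1 - ω) := by nlinarith
    have hx := norm_nonneg x
    calc ‖x - y‖ ≤ (1 + ω) * ‖x‖ := by linarith
      _ ≤ Real.exp (3 * ω) * (1 - ω) * ‖x‖ := by gcongr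
      _ ≤ Real.exp (3 * ω) * ‖x + y‖ := by
        rw [mul_assoc]; gcongr; linarith
  have h0 := annulusWeight_nonneg zero_le_two ht.le z
  have hlt : min (‖z‖ / t) (2 * t / ‖z‖) = annulusWeight 2 t z := by
    unfold annulusWeight at hz ⊢
    rcases min_le_iff.1 hz with h | h
    · norm_num at h
    · rw [min_eq_right (h.trans (by norm_num))]
  rcases min_choice (‖z‖ / t) (2 * t / ‖z‖) with h | h
  · refine key h0 hz ?_
    rw [← hlt, h, div_mul_eq_mul_div, le_div_iff₀ ht]
    exact mul_le_mul_of_nonneg_left hv (norm_nonneg z)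
  · rcases eq_or_ne z 0 with rfl | hz0
    · rw [sub_zero, add_zero]
      exact le_mul_of_one_le_left (norm_nonneg v) (Real.one_le_exp (by positivity))
    rw [norm_sub_rev, add_comm]
    refine key h0 hz ?_
    rw [← hlt, h, div_mul_cancel₀ _ (norm_pos_iff.2 hz0).ne']
    exact hv'

lemma norm_multiset_prod (s : Multiset ℂ) : ‖s.prod‖ = (s.map fun z => ‖z‖).prod := by
  induction s using Multiset.induction_on with
  | empty => simp
  | cons z s ih => simp [ih]

/-- A real polynomial of degree at most `D` cannot be much larger at all integers of an interval
`[2 ^ i, 2 ^ (i + J)]` than at their negatives. -/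
theorem exists_abs_eval_le_exp_mul {F : Polynomial ℝ} {D i J : ℕ} (hD : F.natDegree ≤ D)
    (hJ : 0 < J) (hi : 10 * D ≤ J * 2 ^ i) : ∃ v : ℕ, 1 ≤ v ∧ v ≤ 2 ^ (i + J) ∧
      |F.eval (v : ℝ)| ≤ Real.exp (65 * D / J) * |F.eval (-(v : ℝ))| := by
  have hJ' : (0 : ℝ) < J := by exact_mod_cast hJ
  obtain ⟨j, hj, hw⟩ : ∃ j ∈ Finset.range J, rootWeight 2 (2 ^ j * 2 ^ i) F ≤ 5 * D / J := by
    refine Finset.exists_le_of_sum_le (by simpa using hJ.ne') ?_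
    rw [Finset.sum_const, Finset.card_range, nsmul_eq_mul, mul_div_cancel₀ _ hJ'.ne']
    have h1 := sum_rootWeight_le le_rfl (by positivity : (0 : ℝ) < 2 ^ i) J F
    have h3 : (F.natDegree : ℝ) ≤ D := by exact_mod_cast hD
    linarith
  rw [Finset.mem_range] at hj
  set T : ℕ := 2 ^ j * 2 ^ i with hT
  have hTt : (2 ^ j * 2 ^ i : ℝ) = (T : ℝ) := by simp [hT]
  rw [hTt] at hw
  have hT0 : (0 : ℝ) < T := by rw [← hTt]; positivity
  have hTn : 0 < T := by positivity
  set ω := annulusWeight 2 T with hω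
  have hω0 : ∀ z, 0 ≤ ω z := annulusWeight_nonneg zero_le_two hT0.le
  set s := F.aroots ℂ with hs
  -- Roots near the annulus are few and are treated jointly, by choosing the integer `v` well; for
  -- the others the comparison holds factor by factor at every `v`.
  set s₁ := s.filter fun z => 1 / 2 < ω z with hs₁
  set s₂ := s.filter fun z => ¬ 1 / 2 < ω z with hs₂
  have hsum : (s₁.map ω).sum + (s₂.map ω).sum = rootWeight 2 T F := by
    rw [← Multiset.sum_add, ← Multiset.map_add, Multiset.filter_add_not]; rfl
  have h1 : (s₁.card : ℝ) / 2 ≤ (s₁.map ω).sum := by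
    have : ∀ u : Multiset ℂ, (∀ z ∈ u, 1 / 2 < ω z) → (u.card : ℝ) / 2 ≤ (u.map ω).sum := by
      intro u
      induction u using Multiset.induction_on with
      | empty => simp
      | cons z u ih =>
        intro h
        have a := ih fun w hw => h w (Multiset.mem_cons_of_mem hw)
        have b := h z (Multiset.mem_cons_self z u)
        simp only [Multiset.map_cons, Multiset.sum_cons, Multiset.card_cons]
        push_cast; linarith
    exact this _ fun z hz => (Multiset.mem_filter.1 hz).2
  have h2 : 0 ≤ (s₂.map ω).sum := by
    refine Multiset.sum_nonneg fun w hw => ?_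
    obtain ⟨z, -, rfl⟩ := Multiset.mem_map.1 hw
    exact hω0 z
  -- Each near root costs weight `1/2`, so there are at most `10 D / J ≤ 2 ^ i ≤ T` of them: enough
  -- integers in `[T, 2T]` to avoid their negatives.
  have hcard : s₁.card ≤ T := by
    have a : (s₁.card : ℝ) ≤ 10 * D / J := by
      have : (10 * D / J : ℝ) = 2 * (5 * D / J) := by ring
      linarith
    have b : (10 * D / J : ℝ) ≤ 2 ^ i := by
      rw [div_le_iff₀ hJ', mul_comm]
      rw [mul_comm (_ : ℝ) (J : ℝ), mul_comm (D : ℝ)]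
      exact_mod_cast hi
    have c : (2 ^ i : ℝ) ≤ T := by
      rw [← hTt]; exact le_mul_of_one_le_left (by positivity) (one_le_pow₀ one_le_two)
    exact_mod_cast a.trans (b.trans c)
  obtain ⟨v, hv, hv', hlarge⟩ := exists_large_prod_add s₁ hcard
  have hvR : (T : ℝ) ≤ ‖(v : ℂ)‖ := by simpa using hv
  have hvR' : ‖(v : ℂ)‖ ≤ 2 * T := by
    rw [Complex.norm_natCast]; exact_mod_cast hv'
  refine ⟨v, by omega, ?_, ?_⟩
  · refine hv'.trans ?_
    rw [hT, ← mul_assoc, ← pow_succ', ← pow_add]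
    exact Nat.pow_le_pow_right two_pos (by omega)
  -- Near roots have `‖z‖ ≤ 4T`, so each factor `v - z` is at most `6T`, against `T / 4` and `exp
  -- (-1)` per root below. The loss is at most `24 e ≤ e ^ 5` per root, hence `exp 10` per unit of
  -- weight.
  have near : ‖(s₁.map fun z => (v : ℂ) - z).prod‖ ≤
      Real.exp (10 * (s₁.map ω).sum) * ‖(s₁.map fun z => (v : ℂ) + z).prod‖ := by
    have a : ‖(s₁.map fun z => (v : ℂ) - z).prod‖ ≤ (6 * T : ℝ) ^ s₁.card := by
      rw [norm_multiset_prod, Multiset.map_map]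
      have : ∀ u : Multiset ℂ, (∀ z ∈ u, 1 / 2 < ω z) →
          (u.map ((fun z => ‖z‖) ∘ fun z => (v : ℂ) - z)).prod ≤ (6 * T : ℝ) ^ u.card := by
        intro u
        induction u using Multiset.induction_on with
        | empty => simp
        | cons z u ih =>
          intro h
          have a := ih fun w hw => h w (Multiset.mem_cons_of_mem hw)
          have b := h z (Multiset.mem_cons_self z u)
          have hz : ‖z‖ ≤ 4 * T := by
            rcases eq_or_ne z 0 with rfl | hz0
            · simp
            have : 1 / 2 < 2 * T / ‖z‖ :=
              b.trans_le ((min_le_right _ _).trans (min_le_right _ _))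
            rw [lt_div_iff₀ (norm_pos_iff.2 hz0)] at this
            linarith
          have c : ‖(v : ℂ) - z‖ ≤ 6 * T := (norm_sub_le _ _).trans (by linarith)
          simp only [Multiset.map_cons, Multiset.prod_cons, Multiset.card_cons, Function.comp]
          rw [pow_succ']
          refine mul_le_mul c a ?_ (by positivity)
          refine Multiset.prod_nonneg fun w hw => ?_
          obtain ⟨z, -, rfl⟩ := Multiset.mem_map.1 hw
          exact norm_nonneg _
      exact this _ fun z hz => (Multiset.mem_filter.1 hz).2
    have h24 : (24 : ℝ) ≤ Real.exp 4 := by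
      have h := Real.exp_one_gt_d9
      have : Real.exp 4 = Real.exp 1 ^ 4 := by rw [← Real.exp_nat_mul]; norm_num
      rw [this]
      calc (24 : ℝ) ≤ (2.7 : ℝ) ^ 4 := by norm_num
        _ ≤ _ := by gcongr; linarith
    have b : (6 * T : ℝ) ^ s₁.card ≤
        Real.exp (5 * s₁.card) * ((T / 4 : ℝ) ^ s₁.card * Real.exp (-s₁.card)) := by
      have e1 : Real.exp (5 * s₁.card) * ((T / 4 : ℝ) ^ s₁.card * Real.exp (-s₁.card)) =
          (Real.exp 4 * (T / 4)) ^ s₁.card := by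
        rw [mul_pow, ← Real.exp_nat_mul, mul_left_comm, ← Real.exp_add, mul_comm]
        congr 2; ring
      rw [e1]
      refine pow_le_pow_left₀ (by positivity) ?_ _
      nlinarith
    refine a.trans (b.trans ?_)
    exact mul_le_mul (Real.exp_le_exp.2 (by linarith)) hlarge (by positivity) (by positivity)
  have far : ‖(s₂.map fun z => (v : ℂ) - z).prod‖ ≤
      Real.exp (3 * (s₂.map ω).sum) * ‖(s₂.map fun z => (v : ℂ) + z).prod‖ := by
    have : ∀ u : Multiset ℂ, (∀ z ∈ u, ¬ 1 / 2 < ω z) → ‖(u.map fun z => (v : ℂ) - z).prod‖ ≤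
      Real.exp (3 * (u.map ω).sum) * ‖(u.map fun z => (v : ℂ) + z).prod‖ := by
      intro u
      induction u using Multiset.induction_on with
      | empty => simp
      | cons z u ih =>
        intro h
        have a := ih fun w hw => h w (Multiset.mem_cons_of_mem hw)
        have b := norm_sub_le_exp_mul_norm_add hT0 hvR hvR'
          (not_lt.1 (h z (Multiset.mem_cons_self z u)))
        simp only [Multiset.map_cons, Multiset.prod_cons, Multiset.sum_cons, norm_mul]
        rw [mul_add, Real.exp_add, mul_mul_mul_comm]
        exact mul_le_mul b a (norm_nonneg _) (by positivity)
    exact this _ fun z hz => (Multiset.mem_filter.1 hz).2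
  have split : ∀ f : ℂ → ℂ, (s.map f).prod = (s₁.map f).prod * (s₂.map f).prod := by
    intro f
    rw [← Multiset.prod_add, ← Multiset.map_add, Multiset.filter_add_not]
  have eneg : ‖(s.map fun z => ((-(v : ℝ) : ℝ) : ℂ) - z).prod‖ =
      ‖(s.map fun z => (v : ℂ) + z).prod‖ := by
    rw [norm_multiset_prod, norm_multiset_prod, Multiset.map_map, Multiset.map_map]
    congr 1
    refine Multiset.map_congr rfl fun z _ => ?_
    simp only [Function.comp]
    rw [← norm_neg]; congr 1; push_cast; ring
  have e1 : |F.eval (v : ℝ)| = ‖(F.leadingCoeff : ℂ)‖ * ‖(s.map fun z => (v : ℂ) - z).prod‖ := by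
    rw [← norm_mul]
    have := eval_eq_prod_aroots F v
    rw [Complex.ofReal_natCast] at this
    rw [← this, Complex.norm_real, Real.norm_eq_abs]
  have e2 : |F.eval (-(v : ℝ))| =
      ‖(F.leadingCoeff : ℂ)‖ * ‖(s.map fun z => (v : ℂ) + z).prod‖ := by
    rw [← eneg, ← norm_mul, ← eval_eq_prod_aroots, Complex.norm_real, Real.norm_eq_abs]
  rw [e1, e2, mul_left_comm]
  refine mul_le_mul_of_nonneg_left ?_ (norm_nonneg _)
  rw [split, split, norm_mul, norm_mul]
  calc _ ≤ (Real.exp (10 * (s₁.map ω).sum) * ‖(s₁.map fun z => (v : ℂ) + z).prod‖) *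
        (Real.exp (3 * (s₂.map ω).sum) * ‖(s₂.map fun z => (v : ℂ) + z).prod‖) :=
        mul_le_mul near far (norm_nonneg _) (by positivity)
    _ = Real.exp (10 * (s₁.map ω).sum + 3 * (s₂.map ω).sum) * _ := by
        rw [mul_mul_mul_comm, ← Real.exp_add]
    _ ≤ _ := by
        have h13 : (65 * D / J : ℝ) = 13 * (5 * D / J) := by ring
        have : 0 ≤ (s₁.map ω).sum := le_trans (by positivity) h1
        gcongr
        linarith

/-! ### Averages over the levels of the cube -/

section Level

/-- The coordinates at which a point of the cube is one. -/
def cubeOnes {κ : Type*} [Fintype κ] (y : κ → Bool) : Finset κ :=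
  Finset.univ.filter fun j => y j = true

lemma mem_cubeOnes {κ : Type*} [Fintype κ] {y : κ → Bool} {j : κ} : 
    j ∈ cubeOnes y ↔ y j = true := by simp [cubeOnes]

variable {κ : Type*} [Fintype κ] [DecidableEq κ] {d : ℕ}

lemma cubeOnes_decide (s : Finset κ) : cubeOnes (fun j => decide (j ∈ s)) = s := by
  ext j; simp [mem_cubeOnes]

lemma decide_mem_cubeOnes (y : κ → Bool) : (fun j => decide (j ∈ cubeOnes y)) = y := by
  funext j; simp [mem_cubeOnes]

/-- The points of the cube with exactly `k` ones. -/
def cubeLevel (κ : Type*) [Fintype κ] [DecidableEq κ] (k : ℕ) : Finset (κ → Bool) :=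
  Finset.univ.filter fun y => (cubeOnes y).card = k

lemma mem_cubeLevel {k : ℕ} {y : κ → Bool} : y ∈ cubeLevel κ k ↔ (cubeOnes y).card = k := by
  simp [cubeLevel]

/-- The number of points of a level that lie above `B`. -/
lemma card_filter_cubeLevel (k : ℕ) (B : Finset κ) (hB : B.card ≤ k) :
    ((cubeLevel κ k).filter fun y => B ⊆ cubeOnes y).card =
      (Fintype.card κ - B.card).choose (k - B.card) := by
  have h : (Fintype.card κ - B.card).choose (k - B.card) =
      (Finset.powersetCard (k - B.card) Bᶜ).card := by
    rw [Finset.card_powersetCard, Finset.card_compl]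
  rw [h]
  have hdisj : ∀ s ∈ Finset.powersetCard (k - B.card) Bᶜ, Disjoint s B := fun s hs => by
    rw [Finset.disjoint_left]
    intro j hj
    simpa using (Finset.mem_powersetCard.1 hs).1 hj
  refine Finset.card_bij' (fun y _ => cubeOnes y \ B) (fun s _ j => decide (j ∈ s ∪ B)) ?_ ?_ ?_ ?_
  · intro y hy
    rw [Finset.mem_filter, mem_cubeLevel] at hy
    rw [Finset.mem_powersetCard, Finset.card_sdiff_of_subset hy.2, hy.1]
    exact ⟨fun j hj => by simpa using (Finset.mem_sdiff.1 hj).2, rfl⟩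
  · intro s hs
    rw [Finset.mem_filter, mem_cubeLevel, cubeOnes_decide,
      Finset.card_union_of_disjoint (hdisj s hs), (Finset.mem_powersetCard.1 hs).2]
    exact ⟨by omega, Finset.subset_union_right⟩
  · intro y hy
    rw [Finset.mem_filter] at hy
    simp only [Finset.sdiff_union_of_subset hy.2, decide_mem_cubeOnes]
  · intro s hs
    simp only [cubeOnes_decide]
    exact Finset.union_sdiff_cancel_right (hdisj s hs)

/-- The average of a function over a level of the cube. -/
noncomputable def levelAverage (κ : Type*) [Fintype κ] [DecidableEq κ] (k : ℕ) :
    ((κ → Bool) → ℝ) →ₗ[ℝ] ℝ :=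
  (((Fintype.card κ).choose k : ℝ)⁻¹) • ∑ y ∈ cubeLevel κ k, LinearMap.proj y

lemma levelAverage_apply (k : ℕ) (f : (κ → Bool) → ℝ) :
    levelAverage κ k f = ((Fintype.card κ).choose k : ℝ)⁻¹ * ∑ y ∈ cubeLevel κ k, f y := by
  simp [levelAverage]

lemma levelAverage_le {k : ℕ} {f g : (κ → Bool) → ℝ} (h : ∀ y ∈ cubeLevel κ k, f y ≤ g y) :
    levelAverage κ k f ≤ levelAverage κ k g := by
  rw [levelAverage_apply, levelAverage_apply]
  exact mul_le_mul_of_nonneg_left (Finset.sum_le_sum h) (by positivity)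

lemma cubeLevel_nonempty {k : ℕ} (hk : k ≤ Fintype.card κ) : (cubeLevel κ k).Nonempty := by
  obtain ⟨s, -, hs⟩ := Finset.exists_subset_card_eq (s := (Finset.univ : Finset κ)) (n := k)
    (by simpa using hk)
  exact ⟨fun j => decide (j ∈ s), by rw [mem_cubeLevel, cubeOnes_decide, hs]⟩

lemma levelAverage_pos {k : ℕ} (hk : k ≤ Fintype.card κ) {f : (κ → Bool) → ℝ}
    (h : ∀ y ∈ cubeLevel κ k, 0 < f y) : 0 < levelAverage κ k f := by
  rw [levelAverage_apply]
  have := Nat.choose_pos hk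
  exact mul_pos (by positivity) (Finset.sum_pos h (cubeLevel_nonempty hk))

/-- With `b = B.card` and `N` coordinates, the average is `choose (N - b) (k - b) / choose N k`, the
quotient of the falling factorials of `k` and `N` of length `b`; it also vanishes, as it should, for
`k < b`. -/
lemma exists_polynomial_levelAverage_cubeMonomial (B : Finset κ) : ∃ R : Polynomial ℝ,
    R.natDegree ≤ B.card ∧ ∀ k ≤ Fintype.card κ,
      levelAverage κ k (cubeMonomial B) = R.eval (k : ℝ) := by
  set N := Fintype.card κ with hN
  refine ⟨Polynomial.C (N.descFactorial B.card : ℝ)⁻¹ * descPochhammer ℝ B.card, ?_, fun k hk => ?_⟩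
  · exact (Polynomial.natDegree_C_mul_le _ _).trans (descPochhammer_natDegree ℝ _).le
  have hsum : ∑ y ∈ cubeLevel κ k, cubeMonomial B y =
      (((cubeLevel κ k).filter fun y => B ⊆ cubeOnes y).card : ℝ) := by
    rw [Finset.natCast_card_filter]
    refine Finset.sum_congr rfl fun y _ => ?_
    by_cases h : B ⊆ cubeOnes y
    · rw [if_pos h]
      exact Finset.prod_eq_one fun j hj => by simp [cubePoint, mem_cubeOnes.1 (h hj)]
    · rw [if_neg h]
      obtain ⟨j, hj, hj'⟩ := Finset.not_subset.1 h
      rw [mem_cubeOnes] at hj'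
      exact Finset.prod_eq_zero hj (by simp [cubePoint, hj'])
  have hBN : B.card ≤ N := Finset.card_le_univ B
  rw [levelAverage_apply, hsum, Polynomial.eval_mul, Polynomial.eval_C,
    descPochhammer_eval_eq_descFactorial]
  have h1 : (0 : ℝ) < N.choose k := by exact_mod_cast Nat.choose_pos hk
  have h2 : (0 : ℝ) < N.descFactorial B.card := by
    exact_mod_cast Nat.pos_of_ne_zero (by rw [Ne, Nat.descFactorial_eq_zero_iff_lt]; omega)
  rcases le_or_gt B.card k with hBk | hBk
  · rw [card_filter_cubeLevel k B hBk, ← hN]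
    have h3 : N.choose k * k.descFactorial B.card =
        N.descFactorial B.card * (N - B.card).choose (k - B.card) := by
      rw [Nat.descFactorial_eq_factorial_mul_choose, Nat.descFactorial_eq_factorial_mul_choose,
        mul_left_comm, Nat.choose_mul hBk, mul_assoc]
    have h4 : (N.choose k : ℝ) * k.descFactorial B.card =
        N.descFactorial B.card * (N - B.card).choose (k - B.card) := by exact_mod_cast h3
    field_simp
    linarith
  · rw [Nat.descFactorial_eq_zero_iff_lt.2 hBk]
    have : ((cubeLevel κ k).filter fun y => B ⊆ cubeOnes y) = ∅ := by
      rw [Finset.filter_eq_empty_iff]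
      intro y hy hcon
      rw [mem_cubeLevel] at hy
      have := Finset.card_le_card hcon
      omega
    rw [this]; simp

/-- Symmetrization: the averages over the levels of a function of degree `d` are the values of a
univariate polynomial of degree at most `d`. -/
theorem exists_polynomial_levelAverage {f : (κ → Bool) → ℝ} (hf : f ∈ lowDegree κ d) :
    ∃ R : Polynomial ℝ, R.natDegree ≤ d ∧ ∀ k ≤ Fintype.card κ,
      levelAverage κ k f = R.eval (k : ℝ) := by
  induction hf using Submodule.span_induction with
  | mem f hf =>
    obtain ⟨B, hB, rfl⟩ := hf
    obtain ⟨R, hR, h⟩ := exists_polynomial_levelAverage_cubeMonomial B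
    exact ⟨R, hR.trans hB, h⟩
  | zero => exact ⟨0, by simp, by simp⟩
  | add f g _ _ hf hg =>
    obtain ⟨p, hp, hpe⟩ := hf
    obtain ⟨q, hq, hqe⟩ := hg
    exact ⟨p + q, (Polynomial.natDegree_add_le p q).trans (max_le hp hq),
      fun k hk => by simp [hpe k hk, hqe k hk]⟩
  | smul a f _ hf =>
    obtain ⟨p, hp, hpe⟩ := hf
    exact ⟨a • p, (Polynomial.natDegree_smul_le a p).trans hp, fun k hk => by simp [hpe k hk]⟩

end Level

/-! ### Characters of the cube -/

section Character

variable {ι : Type*} {d : ℕ}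

/-- The character `(-1) ^ (∑ i ∈ S, x i)` of the cube. -/
def cubeCharacter (S : Finset ι) (x : ι → Bool) : ℝ := ∏ i ∈ S, if x i = true then -1 else 1

lemma abs_cubeCharacter (S : Finset ι) (x : ι → Bool) : |cubeCharacter S x| = 1 := by
  unfold cubeCharacter
  rw [Finset.abs_prod]
  exact Finset.prod_eq_one fun i _ => by split_ifs <;> simp

lemma cubeCharacter_mul_self (S : Finset ι) (x : ι → Bool) :
    cubeCharacter S x * cubeCharacter S x = 1 := by
  rw [← abs_mul_abs_self, abs_cubeCharacter, one_mul]

/-- Expand the product of `x i = 1/2 - (-1)^(x i) / 2`. Only subsets of `S` occur, so characters of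
degree at most `d` span `lowDegree`. -/
lemma cubeMonomial_eq_sum_cubeCharacter [DecidableEq ι] (S : Finset ι) (x : ι → Bool) :
    cubeMonomial S x = ∑ T ∈ S.powerset, (1 / 2) ^ T.card * (-1 / 2) ^ (S \ T).card *
      cubeCharacter (S \ T) x := by
  have h : ∀ i, cubePoint x i = 1 / 2 + (-1 / 2) * if x i = true then -1 else 1 := by
    intro i; unfold cubePoint; split_ifs <;> norm_num
  simp only [cubeMonomial, h]
  rw [Finset.prod_add]
  refine Finset.sum_congr rfl fun T _ => ?_
  rw [Finset.prod_mul_distrib, Finset.prod_const, Finset.prod_const, cubeCharacter]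
  ring

/-- For `S ≠ T`, flipping a coordinate that lies in exactly one of them reverses the sign of the
product. -/
lemma sum_cubeCharacter_mul [Fintype ι] [DecidableEq ι] (S T : Finset ι) :
    ∑ x, cubeCharacter S x * cubeCharacter T x = if S = T then 2 ^ Fintype.card ι else 0 := by
  split_ifs with h
  · subst h
    simp [cubeCharacter_mul_self]
  · have flip_mem : ∀ (U : Finset ι) (i : ι) (x : ι → Bool), i ∈ U →
        cubeCharacter U (Function.update x i (!x i)) = -cubeCharacter U x := by
      intro U i x hi
      unfold cubeCharacter
      rw [← Finset.mul_prod_erase _ _ hi, ← Finset.mul_prod_erase _ _ hi, ← neg_mul]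
      congr 1
      · cases x i <;> simp
      · refine Finset.prod_congr rfl fun j hj => ?_
        rw [Function.update_of_ne (Finset.ne_of_mem_erase hj)]
    have flip_notMem : ∀ (U : Finset ι) (i : ι) (x : ι → Bool), i ∉ U →
        cubeCharacter U (Function.update x i (!x i)) = cubeCharacter U x := by
      intro U i x hi
      refine Finset.prod_congr rfl fun j hj => ?_
      rw [Function.update_of_ne (by rintro rfl; exact hi hj)]
    obtain ⟨i, hi⟩ : ∃ i, ¬ (i ∈ S ↔ i ∈ T) := by
      by_contra! hcon
      exact h (Finset.ext hcon)
    have hinv : Function.Involutive fun x : ι → Bool => Function.update x i (!x i) := by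
      intro x; simp
    have hneg : ∀ x, cubeCharacter S (Function.update x i (!x i)) *
        cubeCharacter T (Function.update x i (!x i)) = -(cubeCharacter S x * cubeCharacter T x) := by
      intro x
      by_cases hS : i ∈ S
      · have hT : i ∉ T := fun hT => hi (by simp [hS, hT])
        rw [flip_mem S i x hS, flip_notMem T i x hT, neg_mul]
      · have hT : i ∈ T := by
          by_contra hT
          exact hi (by simp [hS, hT])
        rw [flip_mem T i x hT, flip_notMem S i x hS, mul_neg]
    have := Equiv.sum_comp hinv.toPerm fun x => cubeCharacter S x * cubeCharacter T x
    simp only [Function.Involutive.coe_toPerm, hneg, Finset.sum_neg_distrib] at this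
    linarith

end Character

/-! ### Moment-matching distributions on the fibres of a random linear form -/

section Moments

variable {ι : Type*} [Fintype ι] [DecidableEq ι] {M : ℕ} [NeZero M] {d : ℕ}

/-- The subset sum `∑ z i x i` modulo `M`. -/
def subsetSum (z : ι → ZMod M) (x : ι → Bool) : ZMod M := ∑ i, if x i = true then z i else 0

/-- The deviation of the indicator function of `∑ z i x i = t` from its expected value. -/
noncomputable def fibreDeviation (z : ι → ZMod M) (t : ZMod M) (x : ι → Bool) : ℝ :=
  (if subsetSum z x = t then 1 else 0) - 1 / M

omit [NeZero M] in
lemma subsetSum_add_single (z : ι → ZMod M) (i : ι) (u : ZMod M) (x : ι → Bool) :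
    subsetSum (z + Pi.single i u) x = subsetSum z x + if x i = true then u else 0 := by
  unfold subsetSum
  have : ∀ j, (if x j = true then (z + Pi.single i u : ι → ZMod M) j else 0) =
      (if x j = true then z j else 0) + if j = i then (if x i = true then u else 0) else 0 := by
    intro j
    rcases eq_or_ne j i with rfl | h
    · simp only [Pi.add_apply, Pi.single_eq_same, if_true]; split_ifs <;> simp
    · simp [h]
  simp only [this, Finset.sum_add_distrib, Finset.sum_ite_eq', Finset.mem_univ, if_true]

lemma sum_boole_sub (s : ZMod M) : ∑ u : ZMod M, ((if s = u then (1 : ℝ) else 0) - 1 / M) = 0 := by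
  have hM : (M : ℝ) ≠ 0 := by exact_mod_cast NeZero.ne M
  simp [Finset.sum_sub_distrib, ZMod.card, hM]

/-- Adding `u` to `z i` moves the subset sum at `x` by `u` and leaves the one at `x'` alone;
averaging over `u` kills the deviation at `x`. So deviations at distinct points are uncorrelated
over random `z`. -/
lemma sum_fibreDeviation_mul_of_mem {x x' : ι → Bool} {i : ι} (hx : x i = true) (hx' : x' i = false)
    (t : ZMod M) : ∑ z : ι → ZMod M, fibreDeviation z t x * fibreDeviation z t x' = 0 := by
  have hM : (M : ℝ) ≠ 0 := by exact_mod_cast NeZero.ne M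
  have h : ∀ u : ZMod M, ∑ z : ι → ZMod M, fibreDeviation z t x * fibreDeviation z t x' =
      ∑ z : ι → ZMod M, ((if t - subsetSum z x = u then (1 : ℝ) else 0) - 1 / M) *
        fibreDeviation z t x' := by
    intro u
    rw [← Equiv.sum_comp (Equiv.addRight (Pi.single i u : ι → ZMod M))]
    refine Finset.sum_congr rfl fun z _ => ?_
    have : subsetSum z x + u = t ↔ t - subsetSum z x = u := by
      rw [sub_eq_iff_eq_add, add_comm, eq_comm]
    simp only [fibreDeviation, Equiv.coe_addRight, subsetSum_add_single, hx, hx', if_true, this]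
    simp
  have h2 : (M : ℝ) * ∑ z : ι → ZMod M, fibreDeviation z t x * fibreDeviation z t x' = 0 := by
    calc _ = ∑ _u : ZMod M, ∑ z : ι → ZMod M, fibreDeviation z t x * fibreDeviation z t x' := by
          simp [ZMod.card]
      _ = ∑ u : ZMod M, ∑ z : ι → ZMod M, ((if t - subsetSum z x = u then (1 : ℝ) else 0) - 1 / M) *
        fibreDeviation z t x' := Finset.sum_congr rfl fun u _ => h u
      _ = 0 := by
          rw [Finset.sum_comm]
          refine Finset.sum_eq_zero fun z _ => ?_
          rw [← Finset.sum_mul, sum_boole_sub, zero_mul]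
  exact (mul_eq_zero.1 h2).resolve_left hM

lemma sum_fibreDeviation_mul {x x' : ι → Bool} (hx : x ≠ x') (t : ZMod M) :
    ∑ z : ι → ZMod M, fibreDeviation z t x * fibreDeviation z t x' = 0 := by
  obtain ⟨i, hi⟩ := Function.ne_iff.1 hx
  cases h : x i
  · have h' : x' i = true := by cases h' : x' i <;> simp_all
    simp only [mul_comm (fibreDeviation _ t x)]
    exact sum_fibreDeviation_mul_of_mem h' h t
  · have h' : x' i = false := by cases h' : x' i <;> simp_all
    exact sum_fibreDeviation_mul_of_mem h h' t

omit [DecidableEq ι] in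
lemma sum_fibreDeviation_sq_le (z : ι → ZMod M) (x : ι → Bool) :
    ∑ t, fibreDeviation z t x * fibreDeviation z t x ≤ 1 := by
  have hM : (0 : ℝ) < M := by exact_mod_cast NeZero.pos M
  have h : ∀ t, fibreDeviation z t x * fibreDeviation z t x =
      (if subsetSum z x = t then (1 - 2 / M : ℝ) else 0) + 1 / M * (1 / M) := by
    intro t
    unfold fibreDeviation
    split_ifs <;> ring
  simp only [h, Finset.sum_add_distrib, Finset.sum_ite_eq, Finset.mem_univ, if_true,
    Finset.sum_const, Finset.card_univ, ZMod.card, nsmul_eq_mul]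
  have : (M : ℝ) * (1 / M * (1 / M)) = 1 / M := by field_simp
  rw [this]
  have : (0 : ℝ) < 1 / M := by positivity
  have e : (2 : ℝ) / M = 2 * (1 / M) := by ring
  linarith

/-- The second moment of the deviations, over all choices of the coefficients. -/
lemma sum_sum_sq_fibreDeviation_le {φ : (ι → Bool) → ℝ} (hφ : ∀ x, |φ x| ≤ 1) :
    ∑ z : ι → ZMod M, ∑ t, (∑ x, φ x * fibreDeviation z t x) ^ 2 ≤
      (M : ℝ) ^ Fintype.card ι * 2 ^ Fintype.card ι := by
  have h : ∑ z : ι → ZMod M, ∑ t, (∑ x, φ x * fibreDeviation z t x) ^ 2 =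
      ∑ x, ∑ z : ι → ZMod M, φ x ^ 2 * ∑ t, fibreDeviation z t x * fibreDeviation z t x := by
    calc _ = ∑ t, ∑ z : ι → ZMod M, ∑ x, ∑ x',
            φ x * φ x' * (fibreDeviation z t x * fibreDeviation z t x') := by
          rw [Finset.sum_comm]
          refine Finset.sum_congr rfl fun t _ => Finset.sum_congr rfl fun z _ => ?_
          rw [sq, Finset.sum_mul_sum]
          exact Finset.sum_congr rfl fun x _ => Finset.sum_congr rfl fun x' _ => by ring
      _ = ∑ t, ∑ x, ∑ x', φ x * φ x' *
            ∑ z : ι → ZMod M, fibreDeviation z t x * fibreDeviation z t x' := by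
          refine Finset.sum_congr rfl fun t _ => ?_
          rw [Finset.sum_comm]
          refine Finset.sum_congr rfl fun x _ => ?_
          rw [Finset.sum_comm]
          exact Finset.sum_congr rfl fun x' _ => (Finset.mul_sum _ _ _).symm
      _ = ∑ t, ∑ x, φ x * φ x *
            ∑ z : ι → ZMod M, fibreDeviation z t x * fibreDeviation z t x := by
          refine Finset.sum_congr rfl fun t _ => Finset.sum_congr rfl fun x _ => ?_
          refine Finset.sum_eq_single x (fun x' _ hx' => ?_) (by simp)
          rw [sum_fibreDeviation_mul hx'.symm, mul_zero]
      _ = _ := by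
          rw [Finset.sum_comm]
          refine Finset.sum_congr rfl fun x _ => ?_
          simp only [← Finset.mul_sum, sq]
          rw [Finset.sum_comm]
  rw [h]
  calc _ ≤ ∑ _x : ι → Bool, ∑ _z : ι → ZMod M, (1 : ℝ) := by
        refine Finset.sum_le_sum fun x _ => Finset.sum_le_sum fun z _ => ?_
        have h1 : φ x ^ 2 ≤ 1 := (sq_le_one_iff_abs_le_one _).2 (hφ x)
        have h2 := sum_fibreDeviation_sq_le z x
        have h3 : 0 ≤ ∑ t, fibreDeviation z t x * fibreDeviation z t x :=
          Finset.sum_nonneg fun t _ => mul_self_nonneg _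
        nlinarith [sq_nonneg (φ x)]
    _ = _ := by simp [ZMod.card, mul_comm]

/-- The index sets of the characters of degree at most `d`. -/
def lowDegreeSets (ι : Type*) [Fintype ι] [DecidableEq ι] (d : ℕ) : Finset (Finset ι) :=
  Finset.univ.filter fun S => S.card ≤ d

lemma mem_lowDegreeSets {S : Finset ι} : S ∈ lowDegreeSets ι d ↔ S.card ≤ d := by simp [lowDegreeSets]

/-- Average the second moment over `z`. Since it already contains the sum over `t`, a single `z`
serves all residues. -/
lemma exists_small_correlations (d : ℕ) : ∃ z : ι → ZMod M, ∀ t,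
    ∑ S ∈ lowDegreeSets ι d, ∑ T ∈ lowDegreeSets ι d,
      (∑ x, cubeCharacter S x * cubeCharacter T x * fibreDeviation z t x) ^ 2 ≤
        ((lowDegreeSets ι d).card : ℝ) ^ 2 * 2 ^ Fintype.card ι := by
  set N := (lowDegreeSets ι d).card with hN
  obtain ⟨z, -, hz⟩ : ∃ z ∈ (Finset.univ : Finset (ι → ZMod M)),
      ∑ S ∈ lowDegreeSets ι d, ∑ T ∈ lowDegreeSets ι d, ∑ t,
      (∑ x, cubeCharacter S x * cubeCharacter T x * fibreDeviation z t x) ^ 2 ≤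
        (N : ℝ) ^ 2 * 2 ^ Fintype.card ι := by
    refine Finset.exists_le_of_sum_le Finset.univ_nonempty ?_
    calc _ = ∑ S ∈ lowDegreeSets ι d, ∑ T ∈ lowDegreeSets ι d, ∑ z : ι → ZMod M, ∑ t,
          (∑ x, cubeCharacter S x * cubeCharacter T x * fibreDeviation z t x) ^ 2 := by
          rw [Finset.sum_comm]
          refine Finset.sum_congr rfl fun S _ => ?_
          rw [Finset.sum_comm]
      _ ≤ ∑ S ∈ lowDegreeSets ι d, ∑ T ∈ lowDegreeSets ι d,
          (M : ℝ) ^ Fintype.card ι * 2 ^ Fintype.card ι := by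
          refine Finset.sum_le_sum fun S _ => Finset.sum_le_sum fun T _ => ?_
          refine sum_sum_sq_fibreDeviation_le fun x => ?_
          rw [abs_mul, abs_cubeCharacter, abs_cubeCharacter, one_mul]
      _ = _ := by
          simp [ZMod.card, ← hN]; ring
  refine ⟨z, fun t => le_trans ?_ hz⟩
  refine Finset.sum_le_sum fun S _ => Finset.sum_le_sum fun T _ => ?_
  exact Finset.single_le_sum (f := fun t =>
    (∑ x, cubeCharacter S x * cubeCharacter T x * fibreDeviation z t x) ^ 2)
    (fun t _ => sq_nonneg _) (Finset.mem_univ t)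

/-- A polynomial of degree at most `d` without constant term cannot be negative on a whole fibre
of a linear form with small correlations. -/
lemma exists_nonneg_on_fibre {z : ι → ZMod M} {t : ZMod M}
    (hz : ∑ S ∈ lowDegreeSets ι d, ∑ T ∈ lowDegreeSets ι d,
      (∑ x, cubeCharacter S x * cubeCharacter T x * fibreDeviation z t x) ^ 2 ≤
        ((lowDegreeSets ι d).card : ℝ) ^ 2 * 2 ^ Fintype.card ι)
    (hM : 4 * M ^ 2 * (lowDegreeSets ι d).card ^ 4 < 2 ^ Fintype.card ι)
    (c : Finset ι → ℝ) (hc : c ∅ = 0) :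
    ∃ x, subsetSum z x = t ∧ 0 ≤ ∑ S ∈ lowDegreeSets ι d, c S * cubeCharacter S x := by
  -- With `k` the norm of `c` and `h = 2^(n/2)`, where `n` is the number of coordinates, small
  -- correlations give `∑ p ≥ -k N h` and `∑ p² ≥ (h²/M - N h) k²` over the fibre. If `p < 0` there,
  -- `|p| ≤ N k` yields `∑ p² ≤ N k ∑ |p| ≤ N² h k²`, which contradicts `h > 2 M N²`.
  by_contra! hcon
  set 𝒮 := lowDegreeSets ι d with h𝒮
  set N : ℝ := (𝒮.card : ℝ) with hN
  have hemp : ∅ ∈ 𝒮 := mem_lowDegreeSets.2 (by simp)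
  have hN1 : 1 ≤ N := by
    rw [hN]; exact_mod_cast Finset.card_pos.2 ⟨∅, hemp⟩
  have hMpos : (0 : ℝ) < M := by exact_mod_cast NeZero.pos M
  set h : ℝ := Real.sqrt (2 ^ Fintype.card ι) with hh
  have hh2 : h ^ 2 = 2 ^ Fintype.card ι := Real.sq_sqrt (by positivity)
  have hh0 : 0 < h := Real.sqrt_pos.2 (by positivity)
  have hbig : 2 * M * N ^ 2 < h := by
    refine lt_of_pow_lt_pow_left₀ 2 hh0.le ?_
    rw [hh2]
    have : (4 * M ^ 2 * N ^ 4 : ℝ) < 2 ^ Fintype.card ι := by rw [hN]; exact_mod_cast hM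
    calc (2 * M * N ^ 2 : ℝ) ^ 2 = 4 * M ^ 2 * N ^ 4 := by ring
      _ < _ := this
  set Y : Finset ι → Finset ι → ℝ := fun S T =>
    ∑ x, cubeCharacter S x * cubeCharacter T x * fibreDeviation z t x with hY
  have hYle : ∑ S ∈ 𝒮, ∑ T ∈ 𝒮, Y S T ^ 2 ≤ (N * h) ^ 2 := by
    rw [mul_pow, hh2]; exact hz
  have hNh : 0 ≤ N * h := by positivity
  have hrow : ∑ S ∈ 𝒮, Y S ∅ ^ 2 ≤ (N * h) ^ 2 := by
    refine le_trans (Finset.sum_le_sum fun S _ => ?_) hYle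
    exact Finset.single_le_sum (f := fun T => Y S T ^ 2) (fun T _ => sq_nonneg _) hemp
  set p : (ι → Bool) → ℝ := fun x => ∑ S ∈ 𝒮, c S * cubeCharacter S x with hp
  set k : ℝ := Real.sqrt (∑ S ∈ 𝒮, c S ^ 2) with hk
  have hk2 : k ^ 2 = ∑ S ∈ 𝒮, c S ^ 2 :=
    Real.sq_sqrt (Finset.sum_nonneg fun S _ => sq_nonneg _)
  have hk0 : 0 ≤ k := Real.sqrt_nonneg _
  set D : Finset (ι → Bool) := Finset.univ.filter fun x => subsetSum z x = t with hD
  have hDsum : ∀ f : (ι → Bool) → ℝ,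
      ∑ x ∈ D, f x = (∑ x, f x) / M + ∑ x, f x * fibreDeviation z t x := by
    intro f
    rw [hD, Finset.sum_filter, Finset.sum_div, ← Finset.sum_add_distrib]
    refine Finset.sum_congr rfl fun x _ => ?_
    unfold fibreDeviation
    split_ifs <;> ring
  have hempty : ∀ x : ι → Bool, cubeCharacter ∅ x = 1 := fun x => by simp [cubeCharacter]
  have hfirst : -(k * (N * h)) ≤ ∑ x ∈ D, p x := by
    have e0 : ∑ x, p x = 0 := by
      simp only [hp]
      rw [Finset.sum_comm]
      refine Finset.sum_eq_zero fun S _ => ?_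
      have := sum_cubeCharacter_mul S ∅
      simp only [hempty, mul_one] at this
      rw [← Finset.mul_sum, this]
      split_ifs with hS
      · rw [hS, hc, zero_mul]
      · rw [mul_zero]
    have e1 : ∑ x, p x * fibreDeviation z t x = ∑ S ∈ 𝒮, c S * Y S ∅ := by
      simp only [hp, hY, Finset.sum_mul, Finset.mul_sum]
      rw [Finset.sum_comm]
      exact Finset.sum_congr rfl fun S _ => Finset.sum_congr rfl fun x _ => by rw [hempty]; ring
    rw [hDsum, e0, e1, zero_div, zero_add]
    refine neg_le_of_abs_le (abs_le_of_sq_le_sq ?_ (by positivity))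
    refine (Finset.sum_mul_sq_le_sq_mul_sq _ _ _).trans ?_
    rw [mul_pow, hk2]
    exact mul_le_mul_of_nonneg_left hrow (Finset.sum_nonneg fun S _ => sq_nonneg _)
  have hsecond : (h ^ 2 / M - N * h) * k ^ 2 ≤ ∑ x ∈ D, p x ^ 2 := by
    have hsq : ∀ x, p x ^ 2 = ∑ S ∈ 𝒮, ∑ T ∈ 𝒮, c S * c T * (cubeCharacter S x * cubeCharacter T x) := by
      intro x
      rw [sq, hp, Finset.sum_mul_sum]
      exact Finset.sum_congr rfl fun S _ => Finset.sum_congr rfl fun T _ => by ring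
    have e0 : ∑ x, p x ^ 2 = h ^ 2 * k ^ 2 := by
      simp only [hsq]
      rw [Finset.sum_comm, hk2, Finset.mul_sum]
      refine Finset.sum_congr rfl fun S hS => ?_
      rw [Finset.sum_comm]
      simp only [← Finset.mul_sum, sum_cubeCharacter_mul]
      rw [Finset.sum_eq_single S]
      · rw [if_pos rfl, hh2]; ring
      · intro T _ hT
        rw [if_neg hT.symm, mul_zero]
      · exact fun hS' => absurd hS hS'
    have e1 : ∑ x, p x ^ 2 * fibreDeviation z t x = ∑ S ∈ 𝒮, ∑ T ∈ 𝒮, c S * c T * Y S T := by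
      simp only [hsq, hY, Finset.sum_mul, Finset.mul_sum]
      rw [Finset.sum_comm]
      refine Finset.sum_congr rfl fun S _ => ?_
      rw [Finset.sum_comm]
      exact Finset.sum_congr rfl fun T _ => Finset.sum_congr rfl fun x _ => by ring
    have e2 : |∑ S ∈ 𝒮, ∑ T ∈ 𝒮, c S * c T * Y S T| ≤ k ^ 2 * (N * h) := by
      refine abs_le_of_sq_le_sq ?_ (by positivity)
      rw [← Finset.sum_product' (f := fun S T => c S * c T * Y S T)]
      refine (Finset.sum_mul_sq_le_sq_mul_sq _ (fun q : Finset ι × Finset ι => c q.1 * c q.2)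
        (fun q => Y q.1 q.2)).trans ?_
      rw [Finset.sum_product, Finset.sum_product, mul_pow]
      refine mul_le_mul (le_of_eq ?_) hYle ?_ (by positivity)
      · rw [sq (k ^ 2), hk2, Finset.sum_mul_sum]
        exact Finset.sum_congr rfl fun S _ => Finset.sum_congr rfl fun T _ => by ring
      · exact Finset.sum_nonneg fun S _ => Finset.sum_nonneg fun T _ => sq_nonneg _
    rw [hDsum, e0, e1]
    have := (abs_le.1 e2).1
    have e3 : h ^ 2 * k ^ 2 / M = h ^ 2 / M * k ^ 2 := by ring
    rw [e3]; linarith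
  have hgap : 0 < h ^ 2 / M - N * h := by
    have : N * h < h ^ 2 / M := by
      rw [lt_div_iff₀ hMpos]
      nlinarith [mul_pos hMpos hh0]
    linarith
  have hDne : D.Nonempty := by
    by_contra hne
    rw [Finset.not_nonempty_iff_eq_empty] at hne
    have e := hDsum fun x => cubeCharacter ∅ x * cubeCharacter ∅ x
    rw [sum_cubeCharacter_mul, if_pos rfl, hne, Finset.sum_empty, ← hh2] at e
    have h1 : |Y ∅ ∅| ≤ N * h := by
      refine abs_le_of_sq_le_sq (le_trans ?_ hrow) hNh
      exact Finset.single_le_sum (f := fun S => Y S ∅ ^ 2) (fun T _ => sq_nonneg _) hemp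
    have h2 := (abs_le.1 h1).1
    linarith
  have hpabs : ∀ x, |p x| ≤ N * k := by
    intro x
    refine abs_le_of_sq_le_sq ?_ (by positivity)
    refine (Finset.sum_mul_sq_le_sq_mul_sq _ _ _).trans ?_
    have : ∑ S ∈ 𝒮, cubeCharacter S x ^ 2 = N := by
      simp [sq, cubeCharacter_mul_self, hN]
    rw [this, ← hk2, mul_pow, mul_comm]
    refine mul_le_mul_of_nonneg_right ?_ (by positivity)
    nlinarith
  have hneg : ∀ x ∈ D, p x < 0 := fun x hx => hcon x (Finset.mem_filter.1 hx).2
  have hupper : ∑ x ∈ D, p x ^ 2 ≤ N * k * (k * (N * h)) := by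
    calc ∑ x ∈ D, p x ^ 2 ≤ ∑ x ∈ D, N * k * -p x := by
          refine Finset.sum_le_sum fun x hx => ?_
          have := hneg x hx
          have h1 := hpabs x
          rw [abs_of_neg this] at h1
          nlinarith
      _ = N * k * -∑ x ∈ D, p x := by rw [← Finset.mul_sum, Finset.sum_neg_distrib]
      _ ≤ _ := by gcongr; linarith
  have hkpos : 0 < k := by
    refine lt_of_le_of_ne hk0 fun hk' => ?_
    obtain ⟨x, hx⟩ := hDne
    have h1 := hpabs x
    have h2 := hneg x hx
    rw [← hk', mul_zero] at h1
    exact h2.ne (abs_nonpos_iff.1 h1)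
  have hfinal : (h ^ 2 / M - N * h) * k ^ 2 ≤ N ^ 2 * h * k ^ 2 := by
    refine (hsecond.trans hupper).trans (le_of_eq (by ring))
  have h1 : h ^ 2 / M - N * h ≤ N ^ 2 * h := le_of_mul_le_mul_right hfinal (by positivity)
  have h2 : h ^ 2 / M ≤ 2 * N ^ 2 * h := by nlinarith
  rw [div_le_iff₀ hMpos] at h2
  nlinarith

/-- `μ` and the uniform distribution agree on the characters of degree at most `d`, and these span
`lowDegree ι d`. -/
lemma cubeMonomial_average {μ : (ι → Bool) → ℝ}
    (hμ : ∀ S ∈ lowDegreeSets ι d, ∑ x, μ x * cubeCharacter S x = if S = ∅ then 1 else 0)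
    {f : (ι → Bool) → ℝ} (hf : f ∈ lowDegree ι d) :
    ∑ x, μ x * f x = (∑ x, f x) / 2 ^ Fintype.card ι := by
  induction hf using Submodule.span_induction with
  | mem f hf =>
    obtain ⟨S, hS, rfl⟩ := hf
    simp only [cubeMonomial_eq_sum_cubeCharacter]
    simp only [Finset.mul_sum, Finset.sum_div]
    rw [Finset.sum_comm]
    refine Eq.trans ?_ Finset.sum_comm
    refine Finset.sum_congr rfl fun T _ => ?_
    have h1 := hμ (S \ T) (mem_lowDegreeSets.2 ((Finset.card_le_card Finset.sdiff_subset).trans hS))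
    have h2 := sum_cubeCharacter_mul (S \ T) ∅
    have hempty : ∀ x : ι → Bool, cubeCharacter ∅ x = 1 := fun x => by simp [cubeCharacter]
    simp only [hempty, mul_one] at h2
    simp only [mul_left_comm (μ _), ← Finset.mul_sum, ← Finset.sum_div, h1, h2]
    split_ifs
    · rw [mul_one, mul_div_assoc, div_self (by positivity), mul_one]
    · simp
  | zero => simp
  | add f g _ _ hf hg =>
    simp only [Pi.add_apply, mul_add, Finset.sum_add_distrib, hf, hg, add_div]
  | smul a f _ hf =>
    simp only [Pi.smul_apply, smul_eq_mul, mul_left_comm (μ _), ← Finset.mul_sum, hf, mul_div_assoc]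

/-- For a suitable linear form modulo `M`, each of its fibres carries a probability distribution
that agrees with the uniform distribution on the cube on all polynomials of degree `d`. -/
theorem exists_moment_matching (hM : 4 * M ^ 2 * (lowDegreeSets ι d).card ^ 4 < 2 ^ Fintype.card ι) :
    ∃ z : ι → ZMod M, ∀ t, ∃ μ : (ι → Bool) → ℝ, (∀ x, 0 ≤ μ x) ∧
      (∀ x, μ x ≠ 0 → subsetSum z x = t) ∧ (∑ x, μ x = 1) ∧
      ∀ f ∈ lowDegree ι d, ∑ x, μ x * f x = (∑ x, f x) / 2 ^ Fintype.card ι := by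
  obtain ⟨z, hz⟩ := exists_small_correlations (ι := ι) (M := M) d
  refine ⟨z, fun t => ?_⟩
  let s : Finset ι → ℝ := fun S => if S = ∅ then 1 else 0
  -- The row `none` confines `w` to the fibre; the two rows of each `S` force the mean of its
  -- character to be that of the uniform distribution.
  let A : Option (Bool × Finset ι) → (ι → Bool) → ℝ := fun i x =>
    i.elim (if subsetSum z x = t then 0 else -1) fun q =>
      if q.2 ∈ lowDegreeSets ι d then (if q.1 then 1 else -1) * (cubeCharacter q.2 x - s q.2) else 0
  rcases ville_alternative A with ⟨w, hw0, hw1, hw⟩ | ⟨u, hu0, hu⟩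
  · refine ⟨w, hw0, fun x hx => ?_, hw1, fun f hf => cubeMonomial_average (fun S hS => ?_) hf⟩
    · by_contra hne
      have h := hw none
      have hle : ∀ y, w y * A none y ≤ 0 := fun y => by
        refine mul_nonpos_of_nonneg_of_nonpos (hw0 y) ?_
        simp only [A, Option.elim]
        split_ifs <;> norm_num
      have h0 : ∑ y, w y * A none y = 0 := le_antisymm (Finset.sum_nonpos fun y _ => hle y) h
      have := (Finset.sum_eq_zero_iff_of_nonpos fun y _ => hle y).1 h0 x (Finset.mem_univ x)
      simp only [A, Option.elim, if_neg hne] at this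
      exact hx (by linarith)
    · have h1 := hw (some (true, S))
      have h2 := hw (some (false, S))
      simp only [A, Option.elim, if_pos hS, if_true, one_mul, mul_sub, Finset.sum_sub_distrib,
        ← Finset.sum_mul, hw1] at h1 h2
      have e : ∑ x, w x * ((if false = true then (1 : ℝ) else -1) * cubeCharacter S x) =
          -∑ x, w x * cubeCharacter S x := by
        rw [← Finset.sum_neg_distrib]
        exact Finset.sum_congr rfl fun x _ => by simp
      rw [e] at h2
      simp only [Bool.false_eq_true, if_false] at h2
      show _ = s S
      linarith
  · exfalso
    -- On the fibre the rows `none` and `∅` vanish, so the negative combination has no constant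
    -- term.
    let c : Finset ι → ℝ := fun S => if S = ∅ then 0 else u (some (true, S)) - u (some (false, S))
    obtain ⟨x, hx, hpos⟩ := exists_nonneg_on_fibre (hz t) hM c (by simp [c])
    have h := hu x
    rw [Fintype.sum_option, Fintype.sum_prod_type, Fintype.sum_bool] at h
    simp only [A, Option.elim, hx, if_true, mul_zero, zero_add, Bool.false_eq_true, if_false] at h
    rw [← Finset.sum_add_distrib] at h
    have e : ∑ S ∈ lowDegreeSets ι d, c S * cubeCharacter S x = ∑ S : Finset ι,
        ((u (some (true, S)) * if S ∈ lowDegreeSets ι d then 1 * (cubeCharacter S x - s S) else 0) +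
        u (some (false, S)) * if S ∈ lowDegreeSets ι d then -1 * (cubeCharacter S x - s S) else 0) := by
      rw [← Finset.sum_subset (Finset.subset_univ (lowDegreeSets ι d))]
      · refine Finset.sum_congr rfl fun S hS => ?_
        rw [if_pos hS, if_pos hS]
        simp only [c, s]
        split_ifs with hS0
        · rw [hS0]; simp [cubeCharacter]
        · ring
      · intro S _ hS
        rw [if_neg hS, if_neg hS]; simp
    linarith

end Moments

/-! ### A halfspace that has no good rational approximation -/

section HardHalfspace

variable {ι κ : Type*} [Fintype ι] [DecidableEq ι] [Fintype κ] [DecidableEq κ] {M : ℕ} [NeZero M]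
  {d : ℕ}

/-- The subset sum `∑ z i x i` of the least residues. -/
def natSubsetSum (z : ι → ZMod M) (x : ι → Bool) : ℕ := ∑ i, if x i = true then (z i).val else 0

omit [DecidableEq ι] in
lemma natCast_natSubsetSum (z : ι → ZMod M) (x : ι → Bool) :
    ((natSubsetSum z x : ℕ) : ZMod M) = subsetSum z x := by
  unfold natSubsetSum subsetSum
  rw [Nat.cast_sum]
  refine Finset.sum_congr rfl fun i _ => ?_
  split_ifs <;> simp

omit [DecidableEq ι] in
lemma natSubsetSum_div_le (z : ι → ZMod M) (x : ι → Bool) :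
    natSubsetSum z x / M ≤ Fintype.card ι := by
  have h : natSubsetSum z x ≤ Fintype.card ι * M := by
    unfold natSubsetSum
    refine (Finset.sum_le_card_nsmul Finset.univ _ M fun i _ => ?_).trans (by simp)
    split_ifs
    · exact (ZMod.val_lt _).le
    · exact Nat.zero_le _
  exact Nat.div_le_of_le_mul (by rwa [mul_comm])

omit [DecidableEq ι] in
lemma natSubsetSum_div_eq {z : ι → ZMod M} {x : ι → Bool} {t : ℕ} (ht : t < M)
    (h : subsetSum z x = (t : ZMod M)) :
    t + M * (natSubsetSum z x / M) = natSubsetSum z x := by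
  rw [← natCast_natSubsetSum, ZMod.natCast_eq_natCast_iff', Nat.mod_eq_of_lt ht] at h
  rw [← h]
  exact Nat.mod_add_div _ _

omit [DecidableEq ι] in
lemma natSubsetSum_mem_lowDegree (z : ι → ZMod M) :
    (fun x => (natSubsetSum z x : ℝ)) ∈ lowDegree ι 1 := by
  have : (fun x => (natSubsetSum z x : ℝ)) =
      ∑ i, ((z i).val : ℝ) • fun x : ι → Bool => cubePoint x i := by
    funext x
    simp only [natSubsetSum, Nat.cast_sum, Finset.sum_apply, Pi.smul_apply, smul_eq_mul, cubePoint]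
    refine Finset.sum_congr rfl fun i _ => ?_
    split_ifs <;> simp
  rw [this]
  exact Submodule.sum_mem _ fun i _ => Submodule.smul_mem _ _ (cubePoint_mem_lowDegree i)

omit [Fintype ι] [DecidableEq ι] [Fintype κ] [DecidableEq κ] in
lemma cubeMonomial_elim (S : Finset (ι ⊕ κ)) (x : ι → Bool) (y : κ → Bool) :
    cubeMonomial S (Sum.elim x y) = cubeMonomial S.toLeft x * cubeMonomial S.toRight y := by
  conv_lhs => rw [← Finset.toLeft_disjSum_toRight (u := S)]
  unfold cubeMonomial
  rw [Finset.prod_disjSum]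
  rfl

/-- The expectation of a function of `(x, y)` when `x` has distribution `μ` and `y` is uniformly
distributed on the level given by the quotient of `∑ z i x i` by `M`. -/
noncomputable def fibreAverage (z : ι → ZMod M) (μ : (ι → Bool) → ℝ) (f : (ι ⊕ κ → Bool) → ℝ) : ℝ :=
  ∑ x, μ x * levelAverage κ (natSubsetSum z x / M) fun y => f (Sum.elim x y)

/-- On the fibre of `t` the level of `y` is `(L x - t) / M` with `L = natSubsetSum z`, which has
degree one in `x`. Averaging a monomial over `y` gives a polynomial in this level, still of total
degree at most `d` in `x`, so `μ t` may be replaced by the uniform distribution; then `t` enters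
only polynomially. By `hικ` all levels that occur exist. -/
lemma exists_polynomial_fibreAverage (hικ : Fintype.card ι ≤ Fintype.card κ) {z : ι → ZMod M}
    {μ : ℕ → (ι → Bool) → ℝ} (hsupp : ∀ t x, μ t x ≠ 0 → subsetSum z x = (t : ZMod M))
    (hμ : ∀ t, ∀ f ∈ lowDegree ι d, ∑ x, μ t x * f x = (∑ x, f x) / 2 ^ Fintype.card ι)
    {f : (ι ⊕ κ → Bool) → ℝ} (hf : f ∈ lowDegree (ι ⊕ κ) d) :
    ∃ G : Polynomial ℝ, G.natDegree ≤ d ∧ ∀ t < M, fibreAverage z (μ t) f = G.eval (t : ℝ) := by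
  induction hf using Submodule.span_induction with
  | mem f hf =>
    obtain ⟨S, hS, rfl⟩ := hf
    have hcard : S.toLeft.card + S.toRight.card ≤ d := by
      rwa [Finset.card_toLeft_add_card_toRight]
    obtain ⟨R, hR, hRe⟩ := exists_polynomial_levelAverage_cubeMonomial S.toRight
    refine ⟨∑ x, Polynomial.C ((2 ^ Fintype.card ι : ℝ)⁻¹ * cubeMonomial S.toLeft x) *
      R.comp (Polynomial.C ((natSubsetSum z x : ℝ) / M) - Polynomial.C (1 / M : ℝ) * Polynomial.X),
      ?_, fun t ht => ?_⟩
    · refine Polynomial.natDegree_sum_le_of_forall_le _ _ fun x _ => ?_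
      refine (Polynomial.natDegree_C_mul_le _ _).trans (Polynomial.natDegree_comp_le.trans ?_)
      have h1 : (Polynomial.C ((natSubsetSum z x : ℝ) / M) -
          Polynomial.C (1 / M : ℝ) * Polynomial.X).natDegree ≤ 1 := by
        refine (Polynomial.natDegree_sub_le _ _).trans (max_le (by simp) ?_)
        exact (Polynomial.natDegree_C_mul_le _ _).trans Polynomial.natDegree_X_le
      calc _ ≤ R.natDegree * 1 := Nat.mul_le_mul_left _ h1
        _ ≤ d := by omega
    · have hMR : (M : ℝ) ≠ 0 := by exact_mod_cast NeZero.ne M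
      have hmem : (fun x => cubeMonomial S.toLeft x * R.eval (((natSubsetSum z x : ℝ) - t) / M)) ∈
          lowDegree ι d := by
        have haff : (fun x => ((natSubsetSum z x : ℝ) - t) / M) ∈ lowDegree ι 1 := by
          have : (fun x => ((natSubsetSum z x : ℝ) - t) / M) =
              (1 / M : ℝ) • ((fun x => (natSubsetSum z x : ℝ)) - fun _ => (t : ℝ)) := by
            funext x; simp; ring
          rw [this]
          exact Submodule.smul_mem _ _
            (Submodule.sub_mem _ (natSubsetSum_mem_lowDegree z) (const_mem_lowDegree _))
        refine lowDegree_mono hcard ?_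
        exact lowDegree_mul (cubeMonomial_mem le_rfl) (polynomial_eval_mem_lowDegree haff R hR)
      have h1 : fibreAverage z (μ t) (cubeMonomial S) = ∑ x, μ t x *
          (cubeMonomial S.toLeft x * R.eval (((natSubsetSum z x : ℝ) - t) / M)) := by
        refine Finset.sum_congr rfl fun x _ => ?_
        rcases eq_or_ne (μ t x) 0 with h0 | h0
        · rw [h0, zero_mul, zero_mul]
        congr 1
        have e1 : (fun y => cubeMonomial S (Sum.elim x y)) =
            cubeMonomial S.toLeft x • cubeMonomial S.toRight := by
          funext y; exact cubeMonomial_elim S x y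
        rw [e1, map_smul, smul_eq_mul, hRe _ ((natSubsetSum_div_le z x).trans hικ)]
        have e2 := natSubsetSum_div_eq ht (hsupp t x h0)
        have e3 : (t : ℝ) + M * ((natSubsetSum z x / M : ℕ) : ℝ) = natSubsetSum z x := by
          exact_mod_cast e2
        have e4 : (((natSubsetSum z x : ℝ) - t) / M) = ((natSubsetSum z x / M : ℕ) : ℝ) := by
          rw [div_eq_iff hMR]; linarith
        rw [e4]
      rw [h1, hμ t _ hmem, Polynomial.eval_finsetSum, Finset.sum_div]
      refine Finset.sum_congr rfl fun x _ => ?_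
      simp only [Polynomial.eval_mul, Polynomial.eval_C, Polynomial.eval_comp, Polynomial.eval_sub,
        Polynomial.eval_X]
      have : ((natSubsetSum z x : ℝ) - t) / M = (natSubsetSum z x : ℝ) / M - 1 / M * t := by ring
      rw [this]
      ring
  | zero =>
    refine ⟨0, by simp, fun t _ => ?_⟩
    unfold fibreAverage
    simp only [Polynomial.eval_zero]
    refine Finset.sum_eq_zero fun x _ => ?_
    rw [show (fun y => (0 : (ι ⊕ κ → Bool) → ℝ) (Sum.elim x y)) = 0 from rfl, map_zero, mul_zero]
  | add f g _ _ hf hg =>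
    obtain ⟨p, hp, hpe⟩ := hf
    obtain ⟨q, hq, hqe⟩ := hg
    refine ⟨p + q, (Polynomial.natDegree_add_le p q).trans (max_le hp hq), fun t ht => ?_⟩
    rw [Polynomial.eval_add, ← hpe t ht, ← hqe t ht]
    unfold fibreAverage
    rw [← Finset.sum_add_distrib]
    refine Finset.sum_congr rfl fun x _ => ?_
    rw [← mul_add, ← map_add]
    rfl
  | smul a f _ hf =>
    obtain ⟨p, hp, hpe⟩ := hf
    refine ⟨a • p, (Polynomial.natDegree_smul_le a p).trans hp, fun t ht => ?_⟩
    rw [Polynomial.eval_smul, ← hpe t ht]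
    unfold fibreAverage
    rw [smul_eq_mul, Finset.mul_sum]
    refine Finset.sum_congr rfl fun x _ => ?_
    rw [mul_left_comm, ← smul_eq_mul a, ← map_smul]
    rfl

/-- Only pairs with `∑ z i x i - M |y| = t`, an identity of integers, carry weight. -/
lemma fibreAverage_le {z : ι → ZMod M} {μ : (ι → Bool) → ℝ} {t : ℕ} (ht : t < M)
    (h0 : ∀ x, 0 ≤ μ x) (hsupp : ∀ x, μ x ≠ 0 → subsetSum z x = (t : ZMod M))
    {f g : (ι ⊕ κ → Bool) → ℝ}
    (h : ∀ x y, natSubsetSum z x = t + M * (cubeOnes y).card → f (Sum.elim x y) ≤ g (Sum.elim x y)) :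
    fibreAverage z μ f ≤ fibreAverage z μ g := by
  refine Finset.sum_le_sum fun x _ => ?_
  rcases eq_or_ne (μ x) 0 with hx | hx
  · rw [hx, zero_mul, zero_mul]
  refine mul_le_mul_of_nonneg_left (levelAverage_le fun y hy => h x y ?_) (h0 x)
  rw [mem_cubeLevel.1 hy, natSubsetSum_div_eq ht (hsupp x hx)]

lemma fibreAverage_pos (hικ : Fintype.card ι ≤ Fintype.card κ) {z : ι → ZMod M}
    {μ : (ι → Bool) → ℝ} (h0 : ∀ x, 0 ≤ μ x) (h1 : ∑ x, μ x = 1) {f : (ι ⊕ κ → Bool) → ℝ}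
    (h : ∀ x, 0 < f x) : 0 < fibreAverage z μ f := by
  have hpos : ∀ x, 0 < levelAverage κ (natSubsetSum z x / M) fun y => f (Sum.elim x y) := fun x =>
    levelAverage_pos ((natSubsetSum_div_le z x).trans hικ) fun y _ => h _
  refine lt_of_le_of_ne (Finset.sum_nonneg fun x _ => mul_nonneg (h0 x) (hpos x).le) fun hz => ?_
  have := (Finset.sum_eq_zero_iff_of_nonneg fun x _ => mul_nonneg (h0 x) (hpos x).le).1 hz.symm
  have hall : ∀ x, μ x = 0 := fun x =>
    (mul_eq_zero.1 (this x (Finset.mem_univ x))).resolve_right (hpos x).ne'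
  simp [hall] at h1

omit [NeZero M] in
lemma fibreAverage_smul (z : ι → ZMod M) (μ : (ι → Bool) → ℝ) (a : ℝ) (f : (ι ⊕ κ → Bool) → ℝ) :
    fibreAverage z μ (fun x => a * f x) = a * fibreAverage z μ f := by
  unfold fibreAverage
  rw [Finset.mul_sum]
  refine Finset.sum_congr rfl fun x _ => ?_
  rw [mul_left_comm, ← smul_eq_mul a, ← map_smul]
  rfl

lemma card_lowDegreeSets_le : (lowDegreeSets ι d).card ≤ (Fintype.card ι + 1) ^ d := by
  have hsub : lowDegreeSets ι d ⊆
      (Finset.range (d + 1)).biUnion fun i => Finset.powersetCard i Finset.univ := by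
    intro S hS
    rw [mem_lowDegreeSets] at hS
    rw [Finset.mem_biUnion]
    exact ⟨S.card, by simpa [Nat.lt_succ_iff] using hS, by simp [Finset.mem_powersetCard]⟩
  refine (Finset.card_le_card hsub).trans (Finset.card_biUnion_le.trans ?_)
  rw [add_pow]
  refine Finset.sum_le_sum fun i hi => ?_
  rw [Finset.card_powersetCard, Finset.card_univ, one_pow, mul_one]
  have h1 : 1 ≤ d.choose i := Nat.choose_pos (by simpa [Nat.lt_succ_iff] using hi)
  exact (Nat.choose_le_pow _ _).trans (Nat.le_mul_of_pos_right _ h1)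

/-- There is a threshold function of an integer linear form that has no rational approximation of
degree `d` with quotients in `[a, 1]` in absolute value. -/
theorem exists_threshold_not_approximable (hικ : Fintype.card ι ≤ Fintype.card κ)
    (hM : 4 * M ^ 2 * (lowDegreeSets ι d).card ^ 4 < 2 ^ Fintype.card ι) {B J : ℕ} (hB : 2 ≤ B)
    (hJ : 0 < J) (hJd : 100 * d ≤ J) (hBM : 2 * B ^ J < M) {a : ℝ} (ha : 0 < a) (haB : 2 ≤ a * B) :
    ∃ (w : ι ⊕ κ → ℤ) (c : ℤ), ∀ f : (ι ⊕ κ → Bool) → ℤˣ,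
      (∀ x, f x = if c < ∑ i, (if x i = true then w i else 0) then 1 else -1) →
      ∀ p ∈ lowDegree (ι ⊕ κ) d, ∀ q ∈ lowDegree (ι ⊕ κ) d,
        ¬ ∀ x, 0 < q x ∧ a * q x ≤ ((f x : ℤ) : ℝ) * p x ∧ ((f x : ℤ) : ℝ) * p x ≤ q x := by
  obtain ⟨z, hz⟩ := exists_moment_matching hM
  choose μ hμ0 hsupp hμ1 hμ using fun t : ℕ => hz (t : ZMod M)
  -- With weights `-M` on the second block the form equals `t` on the support of the `t`-th average.
  -- With the threshold at `B ^ J`, all points `B ^ J ± B ^ j`, `j ≤ J`, are residues in `[0, M)`.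
  refine ⟨Sum.elim (fun i => ((z i).val : ℤ)) fun _ => -(M : ℤ), (B ^ J : ℕ), ?_⟩
  intro f hf p hp q hq h
  obtain ⟨P, hP, hPe⟩ := exists_polynomial_fibreAverage hικ hsupp hμ hp
  obtain ⟨Q, hQ, hQe⟩ := exists_polynomial_fibreAverage hικ hsupp hμ hq
  have hfval : ∀ x y (t : ℕ), natSubsetSum z x = t + M * (cubeOnes y).card →
      f (Sum.elim x y) = if B ^ J < t then 1 else -1 := by
    intro x y t hxy
    rw [hf]
    have e : ∑ i : ι ⊕ κ, (if (Sum.elim x y : ι ⊕ κ → Bool) i = true then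
        (Sum.elim (fun i => ((z i).val : ℤ)) fun _ => -(M : ℤ) : ι ⊕ κ → ℤ) i else 0) = t := by
      rw [Fintype.sum_sum_type]
      have e1 : ∑ i, (if x i = true then ((z i).val : ℤ) else 0) = (natSubsetSum z x : ℤ) := by
        unfold natSubsetSum
        rw [Nat.cast_sum]
        refine Finset.sum_congr rfl fun i _ => ?_
        split_ifs <;> simp
      have e2 : ∑ j, (if y j = true then -(M : ℤ) else 0) = -(M * (cubeOnes y).card) := by
        rw [← Finset.sum_filter, Finset.sum_const, nsmul_eq_mul]
        simp only [cubeOnes]; ring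
      exact (congrArg₂ (· + ·) e1 e2).trans (by rw [hxy]; push_cast; ring)
    rw [e]
    exact if_congr Int.ofNat_lt rfl rfl
  have hQpos : ∀ t < M, 0 < Q.eval (t : ℝ) := fun t ht => by
    rw [← hQe t ht]
    exact fibreAverage_pos hικ (hμ0 t) (hμ1 t) fun x => (h x).1
  have hposv : ∀ t < M, B ^ J < t →
      a * Q.eval (t : ℝ) ≤ P.eval (t : ℝ) ∧ P.eval (t : ℝ) ≤ Q.eval (t : ℝ) := by
    intro t ht hlt
    rw [← hQe t ht, ← hPe t ht]
    have hx : ∀ x y, natSubsetSum z x = t + M * (cubeOnes y).card →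
        (((f (Sum.elim x y) : ℤˣ) : ℤ) : ℝ) = 1 := fun x y hxy => by
      rw [hfval x y t hxy, if_pos hlt]; simp
    constructor
    · rw [← fibreAverage_smul]
      refine fibreAverage_le ht (hμ0 t) (hsupp t) fun x y hxy => ?_
      have := (h (Sum.elim x y)).2.1
      rwa [hx x y hxy, one_mul] at this
    · refine fibreAverage_le ht (hμ0 t) (hsupp t) fun x y hxy => ?_
      have := (h (Sum.elim x y)).2.2
      rwa [hx x y hxy, one_mul] at this
  have hnegv : ∀ t < M, ¬ B ^ J < t → a * Q.eval (t : ℝ) ≤ -P.eval (t : ℝ) := by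
    intro t ht hlt
    rw [← hQe t ht, ← hPe t ht, ← fibreAverage_smul, ← neg_one_mul, ← fibreAverage_smul]
    refine fibreAverage_le ht (hμ0 t) (hsupp t) fun x y hxy => ?_
    have := (h (Sum.elim x y)).2.1
    rw [hfval x y t hxy, if_neg hlt] at this
    simpa using this
  set sh : Polynomial ℝ := Polynomial.X + Polynomial.C ((B ^ J : ℕ) : ℝ) with hsh
  have hdeg : ∀ R : Polynomial ℝ, R.natDegree ≤ d → (R.comp sh).natDegree ≤ d := fun R hR => by
    refine Polynomial.natDegree_comp_le.trans ?_
    rw [hsh, Polynomial.natDegree_X_add_C, mul_one]; exact hR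
  have hev : ∀ (R : Polynomial ℝ) (j : ℕ), (R.comp sh).eval ((B : ℝ) ^ j) =
      R.eval ((B ^ J + B ^ j : ℕ) : ℝ) := fun R j => by
    simp [hsh, add_comm]
  have hev' : ∀ (R : Polynomial ℝ) (j : ℕ), j ≤ J → (R.comp sh).eval (-(B : ℝ) ^ j) =
      R.eval ((B ^ J - B ^ j : ℕ) : ℝ) := fun R j hj => by
    rw [Nat.cast_sub (Nat.pow_le_pow_right (by omega) hj)]
    simp [hsh, add_comm, sub_eq_add_neg]
  refine not_sign_approximation (hdeg P hP) (hdeg Q hQ) (B := B) ha (by exact_mod_cast hB) haB hJ hJd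
    (fun j hj => ?_) (fun j hj => ?_)
  · have h1 : B ^ j ≤ B ^ J := Nat.pow_le_pow_right (by omega) hj
    have h2 : 0 < B ^ j := Nat.pow_pos (by omega)
    rw [hev, hev]
    have ht : B ^ J + B ^ j < M := by omega
    exact ⟨hQpos _ ht, hposv _ ht (by omega)⟩
  · have h2 : 0 < B ^ j := Nat.pow_pos (by omega)
    rw [hev' _ j hj, hev' _ j hj]
    have ht : B ^ J - B ^ j < M := by omega
    exact ⟨hQpos _ ht, hnegv _ ht (by omega)⟩

end HardHalfspace

/-- For suitable parameters there is a halfspace on `{0,1}^n` that has no rational approximation of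
degree `d` with quotients in `[a, 1]` in absolute value. -/
theorem exists_halfspace_not_approximable {n d B J : ℕ} (hB : 2 ≤ B) (hJ : 0 < J)
    (hJd : 100 * d ≤ J) (hn : 4 * (2 * B ^ J + 1) ^ 2 * (n / 2 + 1) ^ (4 * d) < 2 ^ (n / 2)) {a : ℝ}
    (ha : 0 < a) (haB : 2 ≤ a * B) :
    ∃ h : (Fin n → Bool) → ℤˣ, IsHalfspace h ∧ ∀ p ∈ lowDegree (Fin n) d, ∀ q ∈ lowDegree (Fin n) d,
      ¬ ∀ x, 0 < q x ∧ a * q x ≤ ((h x : ℤ) : ℝ) * p x ∧ ((h x : ℤ) : ℝ) * p x ≤ q x := by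
  have hcard : 4 * (2 * B ^ J + 1) ^ 2 * (lowDegreeSets (Fin (n / 2)) d).card ^ 4 <
      2 ^ Fintype.card (Fin (n / 2)) := by
    rw [Fintype.card_fin]
    refine lt_of_le_of_lt ?_ hn
    have := card_lowDegreeSets_le (ι := Fin (n / 2)) (d := d)
    rw [Fintype.card_fin] at this
    rw [mul_comm 4 d, pow_mul]
    gcongr
  obtain ⟨w, c, hwc⟩ := exists_threshold_not_approximable (κ := Fin (n - n / 2))
    (by simp only [Fintype.card_fin]; omega) hcard hB hJ hJd (Nat.lt_succ_self _) ha haB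
  let e : Fin n ≃ Fin (n / 2) ⊕ Fin (n - n / 2) :=
    (finCongr (by omega)).trans finSumFinEquiv.symm
  let F : (Fin (n / 2) ⊕ Fin (n - n / 2) → Bool) → ℤˣ := fun x =>
    if c < ∑ i, (if x i = true then w i else 0) then 1 else -1
  -- The form is integer-valued, so with threshold `c + 1 / 2` its sign is never zero.
  refine ⟨fun x => F fun i => x (e.symm i), ⟨fun i => (w (e i) : ℝ), c + 1 / 2, fun x => ?_⟩, ?_⟩
  · have hsum : ∑ i, (w (e i) : ℝ) * cubePoint x i =
        ((∑ i, (if x (e.symm i) = true then w i else 0) : ℤ) : ℝ) := by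
      rw [← Equiv.sum_comp e]
      push_cast
      refine Finset.sum_congr rfl fun i _ => ?_
      rw [Equiv.symm_apply_apply, cubePoint]
      split_ifs <;> simp
    rw [units_eq_sign_iff, hsum]
    simp only [F]
    split_ifs with h
    · have : (c : ℝ) + 1 ≤ ((∑ i, (if x (e.symm i) = true then w i else 0) : ℤ) : ℝ) := by
        exact_mod_cast h
      simp only [Units.val_one, Int.cast_one, one_mul]; linarith
    · have : ((∑ i, (if x (e.symm i) = true then w i else 0) : ℤ) : ℝ) ≤ c := by
        exact_mod_cast not_lt.1 h
      simp only [Units.val_neg, Units.val_one, Int.cast_neg, Int.cast_one]; linarith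
  · intro p hp q hq h
    have hmem : ∀ r ∈ lowDegree (Fin n) d,
        (fun x : Fin (n / 2) ⊕ Fin (n - n / 2) → Bool => r fun i => x (e i)) ∈ lowDegree _ d :=
      fun r hr => lowDegree_comp hr _ fun i => Or.inl ⟨e i, fun _ => rfl⟩
    refine hwc F (fun x => rfl) _ (hmem p hp) _ (hmem q hq) fun x => ?_
    have := h fun i => x (e i)
    simpa using this

/-! ### Rational approximation of the majority function -/

lemma sum_cubePoint {n : ℕ} (y : Fin n → Bool) : ∑ i, cubePoint y i = (cubeOnes y).card := by
  simp only [cubePoint, cubeOnes, Finset.natCast_card_filter]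

lemma majority_eq_neg_one {n k : ℕ} {y : Fin n → Bool} (hy : y ∈ cubeLevel (Fin n) k)
    (hk : n / 2 < k) : majority n y = -1 := by
  unfold majority
  rw [sum_cubePoint, mem_cubeLevel.1 hy, if_pos]
  have : n < 2 * k := by omega
  have : (n : ℝ) < 2 * k := by exact_mod_cast this
  linarith

lemma majority_eq_one {n k : ℕ} {y : Fin n → Bool} (hy : y ∈ cubeLevel (Fin n) k)
    (hk : k ≤ n / 2) : majority n y = 1 := by
  unfold majority
  rw [sum_cubePoint, mem_cubeLevel.1 hy, if_neg]
  have : 2 * k ≤ n := by omega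
  have : (2 * k : ℝ) ≤ n := by exact_mod_cast this
  linarith

/-- The majority function has no rational approximation of low degree with small error. -/
theorem majority_approximation_bound {n d i J : ℕ} {a : ℝ} {P Q : (Fin n → Bool) → ℝ}
    (hP : P ∈ lowDegree (Fin n) (2 * d)) (hQ : Q ∈ lowDegree (Fin n) (2 * d))
    (h : ∀ y, 0 ≤ P y ∧ 0 ≤ Q y ∧
      (majority n y = 1 → P y ≤ 2 * a ^ 2 * Q y ∧ 0 < Q y) ∧
      (majority n y = -1 → Q y ≤ 2 * P y ∧ 0 < P y))
    (hJ : 0 < J) (hi : 40 * d ≤ J * 2 ^ i) (hn : 2 ^ (i + J) ≤ n / 2) :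
    1 ≤ 4 * a ^ 2 * Real.exp (260 * d / J) := by
  obtain ⟨R, hR, hRe⟩ := exists_polynomial_levelAverage hP
  obtain ⟨S, hS, hSe⟩ := exists_polynomial_levelAverage hQ
  rw [Fintype.card_fin] at hRe hSe
  set c : ℕ := n / 2
  -- Pairing mirror-image levels about `c` gives `F (-v) ≤ 4 a² F v` for all integers `1 ≤ v ≤ c`.
  set F : Polynomial ℝ := R.comp (Polynomial.X + Polynomial.C (c : ℝ)) *
    S.comp (-Polynomial.X + Polynomial.C (c : ℝ)) with hF
  have hdeg : F.natDegree ≤ 4 * d := by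
    refine Polynomial.natDegree_mul_le.trans ?_
    have h1 : (R.comp (Polynomial.X + Polynomial.C (c : ℝ))).natDegree ≤ 2 * d := by
      refine Polynomial.natDegree_comp_le.trans ?_
      rw [Polynomial.natDegree_X_add_C, mul_one]; exact hR
    have h2 : (S.comp (-Polynomial.X + Polynomial.C (c : ℝ))).natDegree ≤ 2 * d := by
      refine Polynomial.natDegree_comp_le.trans ?_
      rw [Polynomial.natDegree_add_C, Polynomial.natDegree_neg, Polynomial.natDegree_X, mul_one]
      exact hS
    omega
  obtain ⟨v, hv1, hv2, hv⟩ := exists_abs_eval_le_exp_mul hdeg hJ (i := i) (by omega)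
  have hvc : v ≤ c := hv2.trans hn
  have e1 : F.eval (v : ℝ) = R.eval ((c + v : ℕ) : ℝ) * S.eval ((c - v : ℕ) : ℝ) := by
    rw [hF, Nat.cast_sub hvc]
    simp [add_comm, sub_eq_add_neg]
  have e2 : F.eval (-(v : ℝ)) = R.eval ((c - v : ℕ) : ℝ) * S.eval ((c + v : ℕ) : ℝ) := by
    rw [hF, Nat.cast_sub hvc]
    simp [add_comm, sub_eq_add_neg]
  have hcv : c + v ≤ n := by omega
  have hcv' : c - v ≤ n := by omega
  have hbig : c < c + v := by omega
  rw [e1, e2, ← hRe _ hcv, ← hRe _ hcv', ← hSe _ hcv, ← hSe _ hcv'] at hv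
  set p1 := levelAverage (Fin n) (c + v) P
  set p2 := levelAverage (Fin n) (c - v) P
  set q1 := levelAverage (Fin n) (c + v) Q
  set q2 := levelAverage (Fin n) (c - v) Q
  have hp1 : 0 < p1 := levelAverage_pos (by simpa using hcv) fun y hy =>
    ((h y).2.2.2 (majority_eq_neg_one hy hbig)).2
  have hq2 : 0 < q2 := levelAverage_pos (by simpa using hcv') fun y hy =>
    ((h y).2.2.1 (majority_eq_one hy (Nat.sub_le _ _))).2
  have hq1 : q1 ≤ 2 * p1 := by
    rw [← smul_eq_mul, ← map_smul]
    exact levelAverage_le fun y hy => ((h y).2.2.2 (majority_eq_neg_one hy hbig)).1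
  have hp2 : p2 ≤ 2 * a ^ 2 * q2 := by
    rw [← smul_eq_mul (2 * a ^ 2), ← map_smul]
    exact levelAverage_le fun y hy => ((h y).2.2.1 (majority_eq_one hy (Nat.sub_le _ _))).1
  have hq1' : 0 ≤ q1 := by
    have := levelAverage_le (κ := Fin n) (k := c + v) (f := 0) (g := Q) fun y _ => (h y).2.1
    rwa [map_zero] at this
  have hp2' : 0 ≤ p2 := by
    have := levelAverage_le (κ := Fin n) (k := c - v) (f := 0) (g := P) fun y _ => (h y).1
    rwa [map_zero] at this
  rw [abs_of_pos (mul_pos hp1 hq2), abs_of_nonneg (mul_nonneg hp2' hq1')] at hv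
  have e3 : (65 * ((4 * d : ℕ) : ℝ) / J) = 260 * d / J := by push_cast; ring
  rw [e3] at hv
  have hE := Real.exp_pos (260 * d / J)
  have h3 : p2 * q1 ≤ (2 * a ^ 2 * q2) * (2 * p1) := by gcongr
  have h4 : 1 * (p1 * q2) ≤ 4 * a ^ 2 * Real.exp (260 * d / J) * (p1 * q2) := by
    calc 1 * (p1 * q2) ≤ Real.exp (260 * d / J) * (p2 * q1) := by rw [one_mul]; exact hv
      _ ≤ Real.exp (260 * d / J) * ((2 * a ^ 2 * q2) * (2 * p1)) := by gcongr
      _ = _ := by ring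
  exact le_of_mul_le_mul_right h4 (mul_pos hp1 hq2)

/-! ### Intermediate values of the threshold degree -/

section Restriction

variable {n d : ℕ} {τ : Type*}

lemma IsHalfspace.update {h : (Fin n → Bool) → ℤˣ} (hh : IsHalfspace h) (i : Fin n) (b : Bool) :
    IsHalfspace fun x => h (Function.update x i b) := by
  obtain ⟨a, θ, hs⟩ := hh
  refine ⟨Function.update a i 0, θ - a i * (if b then 1 else 0), fun x => ?_⟩
  rw [hs]
  congr 1
  have h1 : ∑ j, a j * cubePoint (Function.update x i b) j =
      a i * (if b then 1 else 0) + ∑ j ∈ Finset.univ.erase i, a j * cubePoint x j := by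
    rw [← Finset.add_sum_erase _ _ (Finset.mem_univ i)]
    congr 1
    · simp [cubePoint]
    · refine Finset.sum_congr rfl fun j hj => ?_
      simp [cubePoint, Function.update_of_ne (Finset.ne_of_mem_erase hj)]
  have h2 : ∑ j, Function.update a i 0 j * cubePoint x j =
      ∑ j ∈ Finset.univ.erase i, a j * cubePoint x j := by
    rw [← Finset.add_sum_erase _ _ (Finset.mem_univ i)]
    rw [Function.update_self, zero_mul, zero_add]
    refine Finset.sum_congr rfl fun j hj => ?_
    rw [Function.update_of_ne (Finset.ne_of_mem_erase hj)]
  rw [h1, h2]; ring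

/-- Fixing a coordinate to one of its two values lowers the threshold degree by at most one. -/
lemma thresholdDegree_conjunction_le_add_one [Finite τ] {h : (Fin n → Bool) → ℤˣ}
    {g : (τ → Bool) → ℤˣ} (i : Fin n)
    (hd : ∀ b, thresholdDegree (conjunction (fun x => h (Function.update x i b)) g) ≤ d) :
    thresholdDegree (conjunction h g) ≤ d + 1 := by
  obtain ⟨f₀, hf₀, hs₀⟩ := thresholdDegree_le_iff.1 (hd false)
  obtain ⟨f₁, hf₁, hs₁⟩ := thresholdDegree_le_iff.1 (hd true)
  rw [thresholdDegree_le_iff]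
  have hi : (fun z : Fin n ⊕ τ → Bool => cubePoint z (Sum.inl i)) ∈ lowDegree (Fin n ⊕ τ) 1 :=
    cubePoint_mem_lowDegree _
  -- `x i * f₁ + (1 - x i) * f₀` selects the representation of the restriction that applies.
  refine ⟨f₁ * (fun z => cubePoint z (Sum.inl i)) +
    f₀ * ((fun _ => 1) - fun z => cubePoint z (Sum.inl i)),
    Submodule.add_mem _ (lowDegree_mul hf₁ hi)
      (lowDegree_mul hf₀ (Submodule.sub_mem _ (const_mem_lowDegree 1) hi)), ?_⟩
  rw [signRepresents_conjunction_iff] at hs₀ hs₁ ⊢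
  intro x y
  cases hb : x i
  · have e : Function.update x i false = x := by rw [← hb, Function.update_eq_self]
    have := hs₀ x y
    simp only [e] at this
    simpa [cubePoint, hb] using this
  · have e : Function.update x i true = x := by rw [← hb, Function.update_eq_self]
    have := hs₁ x y
    simp only [e] at this
    simpa [cubePoint, hb] using this

lemma thresholdDegree_majority_le (n : ℕ) : thresholdDegree (majority n) ≤ 1 := by
  rw [thresholdDegree_le_iff]
  -- The number of ones is either at most `n / 2` or at least `n / 2 + 1 / 2`; the cut lies halfway
  -- between.
  refine ⟨(fun _ => (n : ℝ) / 2 + 1 / 4) - ∑ i, fun y => cubePoint y i,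
    Submodule.sub_mem _ (const_mem_lowDegree _)
      (Submodule.sum_mem _ fun i _ => cubePoint_mem_lowDegree i), fun y => ?_⟩
  simp only [Pi.sub_apply, Finset.sum_apply]
  unfold majority
  rw [sum_cubePoint]
  split_ifs with h
  · have h1 : n < 2 * (cubeOnes y).card := by
      have : (n : ℝ) < 2 * (cubeOnes y).card := by linarith
      exact_mod_cast this
    have h2 : (n : ℝ) + 1 ≤ 2 * (cubeOnes y).card := by exact_mod_cast h1
    simp only [Units.val_neg, Units.val_one, Int.cast_neg, Int.cast_one]; linarith
  · simp only [Units.val_one, Int.cast_one]; linarith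

lemma thresholdDegree_conjunction_const_le [Finite τ] (u : ℤˣ) {g : (τ → Bool) → ℤˣ}
    (hg : thresholdDegree g ≤ 1) :
    thresholdDegree (conjunction (fun _ : Fin n → Bool => u) g) ≤ 1 := by
  rw [thresholdDegree_le_iff] at hg ⊢
  rcases Int.units_eq_one_or u with rfl | rfl
  · refine ⟨fun _ => 1, const_mem_lowDegree 1, ?_⟩
    rw [signRepresents_conjunction_iff]
    intro x y
    exact ⟨fun h => absurd h.1 (by decide), fun _ => one_pos⟩
  · obtain ⟨f, hf, hs⟩ := hg
    refine ⟨fun z => f fun j => z (Sum.inr j), lowDegree_comp hf _ fun j =>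
      Or.inl ⟨Sum.inr j, fun _ => rfl⟩, ?_⟩
    rw [signRepresents_conjunction_iff]
    intro x y
    have := hs y
    simp only [Sum.elim_inr]
    rcases Int.units_eq_one_or (g y) with h | h <;> rw [h] at this <;> simp [h] at this ⊢ <;>
      exact this

/-- The threshold degrees of the conjunctions of halfspaces with a halfspace `g` form an
interval. -/
theorem exists_halfspace_thresholdDegree_eq [Finite τ] {g : (τ → Bool) → ℤˣ}
    (hg : thresholdDegree g ≤ 1) {T : ℕ} (hT : 1 ≤ T) {h : (Fin n → Bool) → ℤˣ}
    (hh : IsHalfspace h) (hle : T ≤ thresholdDegree (conjunction h g)) :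
    ∃ h' : (Fin n → Bool) → ℤˣ, IsHalfspace h' ∧ thresholdDegree (conjunction h' g) = T := by
  -- `h` depends only on the first `k` coordinates. While its degree exceeds `T`, fix the last of
  -- these: one of the two restrictions still has degree at least `T`. Restrictions remain functions
  -- of `n` bits.
  have key : ∀ k : ℕ, ∀ h : (Fin n → Bool) → ℤˣ, IsHalfspace h →
      (∀ x x' : Fin n → Bool, (∀ i : Fin n, (i : ℕ) < k → x i = x' i) → h x = h x') →
      T ≤ thresholdDegree (conjunction h g) →
      ∃ h' : (Fin n → Bool) → ℤˣ, IsHalfspace h' ∧ thresholdDegree (conjunction h' g) = T := by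
    intro k
    induction k with
    | zero =>
      intro h hh hdep hle
      refine ⟨h, hh, le_antisymm (le_trans ?_ hT) hle⟩
      have : h = fun _ => h fun _ => false := funext fun x => hdep _ _ (by simp)
      rw [this]
      exact thresholdDegree_conjunction_const_le _ hg
    | succ k ih =>
      intro h hh hdep hle
      rcases hle.eq_or_lt with heq | hlt
      · exact ⟨h, hh, heq.symm⟩
      rcases le_or_gt n k with hk | hk
      · exact ih h hh (fun x x' hx => hdep x x' fun i _ => hx i (by omega)) hle
      obtain ⟨b, hb⟩ : ∃ b, T ≤
          thresholdDegree (conjunction (fun x => h (Function.update x ⟨k, hk⟩ b)) g) := by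
        by_contra! hcon
        have := thresholdDegree_conjunction_le_add_one (d := T - 1) (h := h) (g := g) ⟨k, hk⟩
          fun b => by have := hcon b; omega
        omega
      refine ih _ (hh.update ⟨k, hk⟩ b) (fun x x' hx => hdep _ _ fun i hi => ?_) hb
      rcases eq_or_ne i ⟨k, hk⟩ with rfl | hne
      · simp
      · rw [Function.update_of_ne hne, Function.update_of_ne hne]
        have : (i : ℕ) ≠ k := fun h => hne (Fin.ext h)
        exact hx i (by omega)
  exact key n h hh (fun x x' hx => by rw [funext fun i => hx i i.2]) hle

end Restriction

/-! ### The threshold degree of the conjunction of a halfspace and the majority function -/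

lemma cube_mul_le_two_pow {l : ℕ} (hl : 100 ≤ l) : 1000000 * l ^ 3 ≤ 2 ^ l := by
  induction l, hl using Nat.le_induction with
  | base => norm_num
  | succ l hl ih =>
    have : (l + 1) ^ 3 ≤ 2 * l ^ 3 := by nlinarith [mul_le_mul hl hl (by norm_num) (by omega)]
    rw [pow_succ 2]; omega

/-- The degree that is reached by the intersection of a halfspace and the majority function. -/
def intersectionDegree (n : ℕ) : ℕ := Nat.sqrt (n * Nat.log 2 n) / 2000

lemma intersectionDegree_sq_le (n : ℕ) :
    (2000 * intersectionDegree n) ^ 2 ≤ n * Nat.log 2 n := by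
  have h : 2000 * intersectionDegree n ≤ Nat.sqrt (n * Nat.log 2 n) := Nat.mul_div_le _ _
  exact (Nat.pow_le_pow_left h 2).trans (Nat.sqrt_le' _)

lemma lt_intersectionDegree_add_one_sq (n : ℕ) :
    n * Nat.log 2 n < (2000 * (intersectionDegree n + 1)) ^ 2 := by
  have h : Nat.sqrt (n * Nat.log 2 n) + 1 ≤ 2000 * (intersectionDegree n + 1) := by
    unfold intersectionDegree; omega
  exact (Nat.lt_succ_sqrt' _).trans_le (Nat.pow_le_pow_left h 2)

lemma intersectionDegree_pos {n : ℕ} (hl : 100 ≤ Nat.log 2 n) : 0 < intersectionDegree n := by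
  have hn : n ≠ 0 := by rintro rfl; simp at hl
  have h1 : 2 ^ Nat.log 2 n ≤ n := Nat.pow_log_le_self 2 hn
  have h2 := cube_mul_le_two_pow hl
  have h3 := lt_intersectionDegree_add_one_sq n
  by_contra hcon
  have h4 : intersectionDegree n = 0 := by omega
  rw [h4] at h3
  have h5 : 100 ^ 3 ≤ Nat.log 2 n ^ 3 := Nat.pow_le_pow_left hl 3
  nlinarith

/-- A halfspace whose conjunction with the majority function has a large threshold degree. -/
theorem exists_halfspace_lt_thresholdDegree {n : ℕ} (hl : 100 ≤ Nat.log 2 n) :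
    ∃ h : (Fin n → Bool) → ℤˣ, IsHalfspace h ∧
      intersectionDegree n < thresholdDegree (conjunction h (majority n)) := by
  have hdsq := intersectionDegree_sq_le n
  have hd0 := intersectionDegree_pos hl
  set d := intersectionDegree n
  set l := Nat.log 2 n with hl'
  have hn0 : n ≠ 0 := by rintro rfl; simp [hl'] at hl
  have hnl : 2 ^ l ≤ n := Nat.pow_log_le_self 2 hn0
  have hnl' : n < 2 ^ (l + 1) := Nat.lt_pow_succ_log_self (by norm_num) n
  have hl3 : 1000000 * l ^ 3 ≤ n := (cube_mul_le_two_pow hl).trans hnl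
  -- So the factor `(n / 2 + 1) ^ (4 * d) ≤ 2 ^ (4 d (l + 1))` is negligible against `2 ^ (n / 2)`.
  have hdl : 2000000 * (d * l) ≤ n := by
    refine (Nat.pow_le_pow_iff_left two_ne_zero).1 ?_
    calc (2000000 * (d * l)) ^ 2 = 1000000 * l ^ 2 * (2000 * d) ^ 2 := by ring
      _ ≤ 1000000 * l ^ 2 * (n * l) := Nat.mul_le_mul_left _ hdsq
      _ = (1000000 * l ^ 3) * n := by ring
      _ ≤ n * n := Nat.mul_le_mul_right _ hl3
      _ = n ^ 2 := by ring
  have hdle : 100 * d ≤ d * l := by rw [mul_comm]; exact Nat.mul_le_mul_left _ hl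
  -- With `B = 2 ^ s` and `100 d` steps, `B ^ (100 d) ≤ 2 ^ (n / 8)`, so the square of the modulus
  -- fits under `2 ^ (n / 2)`.
  set s := n / (800 * d) with hs
  have hs1 : 800 * (d * s) ≤ n := by
    rw [← mul_assoc]; exact Nat.mul_div_le _ _
  have hs2 : n < 800 * (d * (s + 1)) := by
    rw [← mul_assoc]; exact Nat.lt_mul_div_succ n (by omega)
  have hs5 : 5 ≤ s := (Nat.le_div_iff_mul_le (by omega)).2 (by omega)
  -- Majority uses `J` dyadic scales starting at `2 ^ (l / 2)`: the top, about `n ^ (3/4)`, is below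
  -- `n / 2`, and the bottom is at least `40 d / J`.
  set J := l / 4 with hJ
  have hJ5 : l ≤ 5 * J := by omega
  have hcube : 4 * (2 * (2 ^ s) ^ (100 * d) + 1) ^ 2 * (n / 2 + 1) ^ (4 * d) < 2 ^ (n / 2) := by
    have e1 : 2 * (2 ^ s) ^ (100 * d) + 1 ≤ 2 ^ (100 * (d * s) + 2) := by
      have : (2 ^ s) ^ (100 * d) = 2 ^ (100 * (d * s)) := by rw [← pow_mul]; congr 1; ring
      rw [this, pow_add]
      have : 1 ≤ 2 ^ (100 * (d * s)) := Nat.one_le_two_pow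
      omega
    have e2 : n / 2 + 1 ≤ 2 ^ (l + 1) := by omega
    calc 4 * (2 * (2 ^ s) ^ (100 * d) + 1) ^ 2 * (n / 2 + 1) ^ (4 * d)
        ≤ 2 ^ 2 * (2 ^ (100 * (d * s) + 2)) ^ 2 * (2 ^ (l + 1)) ^ (4 * d) := by
          gcongr; norm_num
      _ = 2 ^ (2 + (100 * (d * s) + 2) * 2 + (4 * (d * l) + 4 * d)) := by
          rw [← pow_mul, ← pow_mul, ← pow_add, ← pow_add]; congr 1; ring
      _ < 2 ^ (n / 2) := by
          refine Nat.pow_lt_pow_right (by norm_num) ?_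
          have : 100 ≤ d * l := le_trans (by omega) hdle
          omega
  have hB : 2 ≤ 2 ^ s := by
    calc 2 = 2 ^ 1 := rfl
      _ ≤ 2 ^ s := Nat.pow_le_pow_right (by norm_num) (by omega)
  have hB0 : (0 : ℝ) < 2 ^ s := by positivity
  -- The smallest ratio that satisfies `2 ≤ a * B`.
  set a : ℝ := 2 / 2 ^ s with ha
  have ha0 : 0 < a := by positivity
  obtain ⟨h, hh, hna⟩ := exists_halfspace_not_approximable hB (by omega : 0 < 100 * d) le_rfl hcube ha0
    (by rw [ha]; push_cast; rw [div_mul_cancel₀ _ hB0.ne'])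
  refine ⟨h, hh, ?_⟩
  by_contra hcon
  rcases rational_approximation_of_conjunction (not_lt.1 hcon) ha0 with
    ⟨p, hp, q, hq, hpq⟩ | ⟨P, hP, Q, hQ, hPQ⟩
  · exact hna p hp q hq hpq
  have hi : 40 * d ≤ J * 2 ^ (l / 2) := by
    have h4 : n ≤ 4 * (2 ^ (l / 2)) ^ 2 := by
      refine hnl'.le.trans ?_
      rw [← pow_mul, show (4 : ℕ) = 2 ^ 2 from rfl, ← pow_add]
      exact Nat.pow_le_pow_right (by norm_num) (by omega)
    refine (Nat.pow_le_pow_iff_left two_ne_zero).1 ?_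
    refine Nat.le_of_mul_le_mul_left (c := 2500) ?_ (by norm_num)
    calc 2500 * (40 * d) ^ 2 = (2000 * d) ^ 2 := by ring
      _ ≤ n * l := hdsq
      _ ≤ (4 * (2 ^ (l / 2)) ^ 2) * (5 * J) := Nat.mul_le_mul h4 hJ5
      _ = 20 * J * (2 ^ (l / 2)) ^ 2 := by ring
      _ ≤ 2500 * J ^ 2 * (2 ^ (l / 2)) ^ 2 := by
          refine Nat.mul_le_mul_right _ ?_
          nlinarith
      _ = 2500 * (J * 2 ^ (l / 2)) ^ 2 := by ring
  have hn2 : 2 ^ (l / 2 + J) ≤ n / 2 := by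
    rw [Nat.le_div_iff_mul_le (by norm_num), ← pow_succ]
    exact (Nat.pow_le_pow_right (by norm_num) (by omega)).trans hnl
  have hmaj := majority_approximation_bound hP hQ hPQ (by omega : 0 < J) hi hn2
  have hJR : (0 : ℝ) < J := by exact_mod_cast (by omega : 0 < J)
  -- Here `4 a² = 2 ^ (4 - 2 s)`, so the majority bound would force `exp (260 d / J) ≥ 2 ^ (2 s -
  -- 4)`. Since `260 < 400 log 2`, this inequality refutes it; `5 ≤ s` gives `s + 1 ≤ 2 s - 4`.
  have hkey : 400 * d ≤ (2 * s - 4) * J := by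
    have h1 : (s + 1) * l ≤ (2 * s - 4) * (5 * J) := Nat.mul_le_mul (by omega) hJ5
    have h2 : (2000 * d) ^ 2 ≤ 800 * (d * (s + 1)) * l := hdsq.trans (Nat.mul_le_mul_right _ hs2.le)
    have h3 : (800 * d) * (5000 * d) ≤ (800 * d) * (5 * ((2 * s - 4) * J)) := by
      calc (800 * d) * (5000 * d) = (2000 * d) ^ 2 := by ring
        _ ≤ 800 * (d * (s + 1)) * l := h2
        _ = 800 * d * ((s + 1) * l) := by ring
        _ ≤ 800 * d * ((2 * s - 4) * (5 * J)) := Nat.mul_le_mul_left _ h1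
        _ = _ := by ring
    have h4 := Nat.le_of_mul_le_mul_left h3 (by omega)
    omega
  have hexp : Real.exp (260 * d / J) < 2 ^ (2 * s - 4) := by
    have h1 : (260 * d / J : ℝ) < ((2 * s - 4 : ℕ) : ℝ) * Real.log 2 := by
      rw [div_lt_iff₀ hJR]
      have h2 : (400 * d : ℝ) ≤ ((2 * s - 4 : ℕ) : ℝ) * J := by exact_mod_cast hkey
      have h3 := Real.log_two_gt_d9
      have h4 : (0 : ℝ) < d := by exact_mod_cast hd0
      nlinarith
    calc Real.exp (260 * d / J) < Real.exp (((2 * s - 4 : ℕ) : ℝ) * Real.log 2) :=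
          Real.exp_lt_exp.2 h1
      _ = 2 ^ (2 * s - 4) := by rw [Real.exp_nat_mul, Real.exp_log two_pos]
  have hfin : 4 * a ^ 2 * 2 ^ (2 * s - 4) = 1 := by
    have : (2 : ℝ) ^ s * 2 ^ s = 2 ^ (2 * s - 4) * 16 := by
      rw [← pow_add, show (16 : ℝ) = 2 ^ 4 by norm_num, ← pow_add]
      congr 1; omega
    rw [ha, div_pow, sq (2 ^ s), this]
    field_simp
    norm_num
  have : 4 * a ^ 2 * Real.exp (260 * d / J) < 4 * a ^ 2 * 2 ^ (2 * s - 4) := by gcongr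
  linarith

theorem theorem6p3 :
    ∃ h : (n : ℕ) → (Fin n → Bool) → ℤˣ,
      (∀ n : ℕ, IsHalfspace (h n)) ∧
      (fun n : ℕ => (thresholdDegree (conjunction (h n) (majority n)) : ℝ))
        =Θ[atTop] (fun n : ℕ => Real.sqrt ((n : ℝ) * Real.logb 2 (n : ℝ))) := by
  have hex : ∀ n : ℕ, ∃ h : (Fin n → Bool) → ℤˣ, IsHalfspace h ∧ (100 ≤ Nat.log 2 n →
      thresholdDegree (conjunction h (majority n)) = intersectionDegree n + 1) := by
    intro n
    by_cases hl : 100 ≤ Nat.log 2 n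
    · obtain ⟨h, hh, hlt⟩ := exists_halfspace_lt_thresholdDegree hl
      obtain ⟨h', hh', he⟩ := exists_halfspace_thresholdDegree_eq (thresholdDegree_majority_le n)
        (Nat.succ_pos _) hh hlt
      exact ⟨h', hh', fun _ => he⟩
    · exact ⟨fun _ => 1, ⟨0, -1, fun x => by simp⟩, fun h => absurd h hl⟩
  choose h hh hdeg using hex
  refine ⟨h, hh, ?_⟩
  have hlarge : ∀ᶠ n : ℕ in atTop, 100 ≤ Nat.log 2 n := by
    filter_upwards [eventually_ge_atTop (2 ^ 100)] with n hn
    exact (Nat.le_log_iff_pow_le (by norm_num) (by positivity)).2 hn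
  have hlog : ∀ n : ℕ, 100 ≤ Nat.log 2 n →
      (n * Nat.log 2 n : ℝ) ≤ n * Real.logb 2 n ∧ n * Real.logb 2 n ≤ 2 * (n * Nat.log 2 n : ℝ) := by
    intro n hl
    have hn0 : n ≠ 0 := by rintro rfl; simp at hl
    have hnpos : (0 : ℝ) < n := by exact_mod_cast Nat.pos_of_ne_zero hn0
    have h1 : (Nat.log 2 n : ℝ) ≤ Real.logb 2 n := Real.natLog_le_logb n 2
    have h2 : Real.logb 2 n ≤ Nat.log 2 n + 1 := by
      rw [Real.logb_le_iff_le_rpow one_lt_two hnpos]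
      have := (Nat.lt_pow_succ_log_self (by norm_num : 1 < 2) n).le
      exact_mod_cast this
    have h3 : (100 : ℝ) ≤ Nat.log 2 n := by exact_mod_cast hl
    constructor
    · gcongr
    · nlinarith
  constructor
  · refine IsBigO.of_bound 1 ?_
    filter_upwards [hlarge] with n hl
    rw [Real.norm_of_nonneg (Nat.cast_nonneg _), Real.norm_of_nonneg (Real.sqrt_nonneg _), one_mul,
      hdeg n hl]
    refine Real.le_sqrt_of_sq_le (le_trans ?_ (hlog n hl).1)
    have h1 := intersectionDegree_sq_le n
    -- Positivity lets the factor `2000` absorb the `+ 1`.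
    have h2 := intersectionDegree_pos hl
    have h3 : (intersectionDegree n + 1) ^ 2 ≤ n * Nat.log 2 n :=
      (Nat.pow_le_pow_left (by omega) 2).trans h1
    exact_mod_cast h3
  · refine IsBigO.of_bound 4000 ?_
    filter_upwards [hlarge] with n hl
    rw [Real.norm_of_nonneg (Nat.cast_nonneg _), Real.norm_of_nonneg (Real.sqrt_nonneg _),
      hdeg n hl]
    refine Real.sqrt_le_iff.2 ⟨by positivity, (hlog n hl).2.trans ?_⟩
    have h1 : (n * Nat.log 2 n : ℝ) ≤ (2000 * ((intersectionDegree n + 1 : ℕ) : ℝ)) ^ 2 := by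
      exact_mod_cast (lt_intersectionDegree_add_one_sq n).le
    have h2 := sq_nonneg (((intersectionDegree n + 1 : ℕ) : ℝ))
    nlinarith
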